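/- Let $t\in\mathbb{R}$, $x\in\mathbb{R}^3$, $r=|x|$, $\partial_0=\partial_t$, $\partial_i=\partial_{x_i}$ $(i=1,2,3)$, $\Box=-\partial_t^2+\Delta_x$ and $\widehat\omega=(\widehat\omega_\alpha)_{\alpha=0}^3=(-1,x/r)$. For $T,\rho\in\mathbb{R}$ put $$\Omega_{T,\rho}=\{(t,x)\in\mathbb{R}^{1+3}:\ t\ge T,\ |x|-t>\rho\},$$ and for $\delta\in(0,1/2)$ and $t>0$ put $f_\delta(t,x)=r-t-\delta^{-1}t^{-\delta}$. There are universal constants $C>0$ and $\tau_0>1$ such that the following holds. Let $R,R''\in\mathbb{R}$ with $R''<R$, let $T_s>|R''|+1$, $0<\gamma\le 1$ and $C_1\in\mathbb{R}$. Then there is $T_*\ge T_s$, depending only on $T_s,R,R'',C_1,\gamma$, with the following property. Let $N\in\mathbb{N}$ and let $V^{I,\alpha}_J,W^I_J$ $(1\le I,J\le N$, $0\le\alpha\le3)$ be continuous real-valued functions on $\Omega_{T_s,R''}$ such that, for all $(t,x)\in\Omega_{T_s,R''}$, $$\sum_{I,J=1}^N\sum_{\alpha=0}^3|V^{I,\alpha}_J|\le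 C_1(1+t+r)^{-1},\qquad \sum_{I,J=1}^N\Big|\sum_{\alpha=0}^3V^{I,\alpha}_J\widehat\omega_\alpha\Big|+\sum_{I,J=1}^N|W^I_J|\le C_1(1+t+r)^{-1-\gamma}.$$ For $\mathbb{R}^N$-valued $\phi=(\phi^I)$ define $(\widetilde\Box\phi)^I=\Box\phi^I+\sum_{J,\alpha}V^{I,\alpha}_J\partial_\alpha\phi^J+\sum_JW^I_J\phi^J$, and for $R'\in\mathbb{R}$ define $$\widetilde\Box_{\tau,\delta,R'}\psi=e^{\tau(f_\delta-R')}\,\widetilde\Box\big(e^{-\tau(f_\delta-R')}\psi\big).$$ Then for every $R'\in(R'',R)$, every $T_0\ge T_*$, every $\tau\ge\tau_0$, every $\delta\in(0,\gamma)$ with $\delta<1/2$, and every $\psi\in C^2(\mathbb{R}^{1+3};\mathbb{R}^N)$ whose support is compact and contained in $\Omega_{T_0,R''}\cap\{r-t<R\}$, $$\tau\int_{\Omega_{T_0,R''}}\big[|\partial_t\psi|^2+(\tau|\psi|)^2\big]\,t^{-\delta}\,dx\,dt\ \le\ C\int_{\Omega_{T_0,R''}}\big|\widetilde\Box_{\tau,\delta,R'}\psi\big|^2\,t^2\,dx\,dt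 .$$ In particular $C$ is independent of $\tau,T_0,\delta,\psi$, and $T_*$ is independent of $R'$. -/

import Mathlib

noncomputable section

/-- Points `(t, x)` of `ℝ × ℝ³`; the volume on it is Lebesgue measure `dx dt`.
For `p : Spacetime` we have `t = p.1` and `r = |x| = ‖p.2‖` (Euclidean norm). -/
abbrev Spacetime : Type := ℝ × EuclideanSpace ℝ (Fin 3)

namespace Spacetime

/-- The coordinate vector in the direction `α`: time is `0`, space is `1, 2, 3`. -/
def coordVec (α : Fin 4) : Spacetime :=
  Fin.cases (1, 0) (fun i : Fin 3 => (0, EuclideanSpace.single i 1)) α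

/-- The partial derivative `∂_α g`, where `∂_0 = ∂_t` and `∂_i = ∂_{x_i}`. -/
def partialDeriv {F : Type*} [NormedAddCommGroup F] [NormedSpace ℝ F]
    (α : Fin 4) (g : Spacetime → F) (p : Spacetime) : F :=
  fderiv ℝ g p (coordVec α)

/-- The wave operator `□ = -∂_t² + ∂_1² + ∂_2² + ∂_3²`. -/
def box (g : Spacetime → ℝ) (p : Spacetime) : ℝ :=
  -partialDeriv 0 (partialDeriv 0 g) p
    + (∑ i : Fin 3, partialDeriv i.succ (partialDeriv i.succ g) p)

/-- The covector `ω̂ = (-1, x / r)`. -/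
def omegaHat (p : Spacetime) (α : Fin 4) : ℝ :=
  Fin.cases (-1) (fun i : Fin 3 => p.2 i / ‖p.2‖) α

/-- The region `{(t, x) : t ≥ T, |x| - t > ρ}`. -/
def region (T ρ : ℝ) : Set Spacetime :=
  {p | T ≤ p.1 ∧ ρ < ‖p.2‖ - p.1}

/-- The weight `f_δ(t, x) = r - t - δ⁻¹ t^{-δ}` (used for `t > 0`). -/
def weight (δ : ℝ) (p : Spacetime) : ℝ :=
  ‖p.2‖ - p.1 - δ⁻¹ * p.1 ^ (-δ)

/-- The linear operator with
`(Lφ)^I = □ φ^I + ∑_{J, α} V_J^{I,α} ∂_α φ^J + ∑_J W_J^I φ^J`.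
Here `V I J α` is `V_J^{I,α}` and `W I J` is `W_J^I`. -/
def waveOp {N : ℕ} (V : Fin N → Fin N → Fin 4 → Spacetime → ℝ)
    (W : Fin N → Fin N → Spacetime → ℝ)
    (φ : Spacetime → EuclideanSpace ℝ (Fin N)) (p : Spacetime) :
    EuclideanSpace ℝ (Fin N) :=
  WithLp.toLp 2 fun I =>
    box (fun q => φ q I) p
      + (∑ J, ∑ α, V I J α p * partialDeriv α (fun q => φ q J) p)
      + (∑ J, W I J p * φ p J)

/-- The conjugated operator `ψ ↦ e^{τ(f_δ - R')} L (e^{-τ(f_δ - R')} ψ)`. -/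
def conjWaveOp {N : ℕ} (V : Fin N → Fin N → Fin 4 → Spacetime → ℝ)
    (W : Fin N → Fin N → Spacetime → ℝ) (τ δ R' : ℝ)
    (ψ : Spacetime → EuclideanSpace ℝ (Fin N)) (p : Spacetime) :
    EuclideanSpace ℝ (Fin N) :=
  Real.exp (τ * (weight δ p - R')) •
    waveOp V W (fun q => Real.exp (-(τ * (weight δ q - R'))) • ψ q) p

/-- The pointwise bounds on the coefficients in the region `Ω`:
`∑_{I,J,α} |V_J^{I,α}| ≤ C₁ (1+t+r)^{-1}` and
`∑_{I,J} |∑_α V_J^{I,α} ω̂_α| + ∑_{I,J} |W_J^I| ≤ C₁ (1+t+r)^{-1-γ}`. -/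
def CoeffBounds {N : ℕ} (V : Fin N → Fin N → Fin 4 → Spacetime → ℝ)
    (W : Fin N → Fin N → Spacetime → ℝ) (C₁ γ : ℝ) (Ω : Set Spacetime) : Prop :=
  (∀ p ∈ Ω, (∑ I, ∑ J, ∑ α, |V I J α p|) ≤ C₁ * (1 + p.1 + ‖p.2‖) ^ (-1 : ℝ)) ∧
  (∀ p ∈ Ω, (∑ I, ∑ J, |∑ α, V I J α p * omegaHat p α|) + (∑ I, ∑ J, |W I J p|)
    ≤ C₁ * (1 + p.1 + ‖p.2‖) ^ (-1 - γ))

end Spacetime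

end

/-!
The proof is the multiplier method for the conjugated operator, carried out pointwise. Write
`X = b ∂_t + ∂_r`, `b = 1 - t^{-1-δ}`, for the gradient of the weight `f_δ`. For `u = r ψ` all zeroth
order terms of size `τ / r` disappear, and `r` times the conjugated wave operator becomes
`G = □u - (2/r) ∂_r u - 2τ X u + τ² (1 - b²) u` up to the harmless term `τ b' u`
(`box_conjFactor_mul`).

Pairing `G` with `-2τ h X u`, where `h = 1 + t^{-1/2}` depends on time only, gives a positive term
`4τ² h (X u)²`, which pays for the product `h G X u`, and the pairing of `X u` with the symmetric
part, which is the divergence of an energy current plus bulk terms (`div_current`). For large `t`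
the bulk terms are positive (`coercive_bulk`): they control, with weights of the orders indicated,
* the outgoing derivative `(∂_t + ∂_r) u` with `τ t^{-1}`,
* the radial derivative with `τ t^{-2-δ}` and `u` itself with `τ³ t^{-2-δ}`,
* the angular derivatives with `τ t^{-3/2}`.
The correction `t^{-1/2}` in `h` is what makes the angular term positive; its exponent does not
depend on `δ`, hence neither do the constants. Since `δ < 1/2`, the other coefficients, of the type
`(1 - δ) t^{-2-δ}`, are bounded below uniformly in `δ`.

The null structure of the first order perturbation now enters. Its part along the outgoing
and angular derivatives has coefficients of size `1/t`, while the radial derivative and `τ u` come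
with `∑ V ω̂`, of size `t^{-1-γ}`, or with further decay. Each product is absorbed by the matching
bulk term, with a gain of a power of `t` because `δ < γ`; this fixes `T_*`
(`perturbation_absorbed`, `exists_late_time`). The result is a pointwise inequality up to a
divergence (`pointwise_carleman`). The current is `C¹` with compact support inside
`{t > 0, r > 0}`, so its divergence integrates to zero (`integrated_carleman`).
-/

noncomputable section
namespace Spacetime
open MeasureTheory Set Topology

/-! ### Partial derivatives and the divergence theorem -/

/-- `g` is differentiable at `p` and its partial derivative `∂_α g` at `p` is the given number. -/
def HasPartial (α : Fin 4) (g : Spacetime → ℝ) (g' : ℝ) (p : Spacetime) : Prop :=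
  ∃ L : Spacetime →L[ℝ] ℝ, HasFDerivAt g L p ∧ L (coordVec α) = g'

namespace HasPartial

variable {α : Fin 4} {f g : Spacetime → ℝ} {f' g' : ℝ} {p : Spacetime}

theorem partialDeriv_eq (hg : HasPartial α g g' p) : partialDeriv α g p = g' := by
  obtain ⟨L, hL, rfl⟩ := hg
  rw [partialDeriv, hL.fderiv]

theorem of_differentiableAt (hg : DifferentiableAt ℝ g p) :
    HasPartial α g (partialDeriv α g p) p :=
  ⟨_, hg.hasFDerivAt, rfl⟩

theorem congr_deriv (hg : HasPartial α g g' p) (h : g' = f') : HasPartial α g f' p := h ▸ hg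

theorem congr_of_eventuallyEq (hg : HasPartial α g g' p) (h : f =ᶠ[𝓝 p] g) :
    HasPartial α f g' p := by
  obtain ⟨L, hL, rfl⟩ := hg
  exact ⟨L, hL.congr_of_eventuallyEq h, rfl⟩

theorem add (hf : HasPartial α f f' p) (hg : HasPartial α g g' p) :
    HasPartial α (fun q => f q + g q) (f' + g') p := by
  obtain ⟨L, hL, rfl⟩ := hf
  obtain ⟨M, hM, rfl⟩ := hg
  exact ⟨_, hL.add hM, rfl⟩

theorem sub (hf : HasPartial α f f' p) (hg : HasPartial α g g' p) :
    HasPartial α (fun q => f q - g q) (f' - g') p := by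
  obtain ⟨L, hL, rfl⟩ := hf
  obtain ⟨M, hM, rfl⟩ := hg
  exact ⟨_, hL.sub hM, rfl⟩

theorem mul (hf : HasPartial α f f' p) (hg : HasPartial α g g' p) :
    HasPartial α (fun q => f q * g q) (f' * g p + f p * g') p := by
  obtain ⟨L, hL, rfl⟩ := hf
  obtain ⟨M, hM, rfl⟩ := hg
  refine ⟨_, hL.mul hM, ?_⟩
  simp only [_root_.add_apply, _root_.smul_apply, smul_eq_mul]
  ring

theorem const_mul (c : ℝ) (hg : HasPartial α g g' p) :
    HasPartial α (fun q => c * g q) (c * g') p := by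
  obtain ⟨L, hL, rfl⟩ := hg
  exact ⟨_, hL.const_mul c, rfl⟩

theorem sq (hg : HasPartial α g g' p) :
    HasPartial α (fun q => g q ^ 2) (2 * g p * g') p := by
  simp only [pow_two]
  exact (hg.mul hg).congr_deriv (by ring)

theorem sum {ι : Type*} {s : Finset ι} {F : ι → Spacetime → ℝ} {F' : ι → ℝ}
    (h : ∀ i ∈ s, HasPartial α (F i) (F' i) p) :
    HasPartial α (fun q => ∑ i ∈ s, F i q) (∑ i ∈ s, F' i) p := by
  choose! L hL hL' using h
  refine ⟨∑ i ∈ s, L i, HasFDerivAt.fun_sum hL, ?_⟩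
  rw [_root_.sum_apply]
  exact Finset.sum_congr rfl hL'

/-- Chain rule for a function of one real variable. -/
theorem comp {c : ℝ → ℝ} {c' : ℝ} (hc : HasDerivAt c c' (g p)) (hg : HasPartial α g g' p) :
    HasPartial α (fun q => c (g q)) (c' * g') p := by
  obtain ⟨L, hL, rfl⟩ := hg
  exact ⟨_, hc.comp_hasFDerivAt p hL, rfl⟩

end HasPartial

@[simp] theorem coordVec_zero : coordVec 0 = (1, 0) := rfl

@[simp] theorem coordVec_succ (i : Fin 3) : coordVec i.succ = (0, EuclideanSpace.single i 1) := rfl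

theorem hasPartial_time_zero (p : Spacetime) : HasPartial 0 (fun q => q.1) 1 p :=
  ⟨_, hasFDerivAt_fst, rfl⟩

theorem hasPartial_time_succ (i : Fin 3) (p : Spacetime) :
    HasPartial i.succ (fun q => q.1) 0 p :=
  ⟨_, hasFDerivAt_fst, rfl⟩

theorem hasPartial_coord_zero (j : Fin 3) (p : Spacetime) :
    HasPartial 0 (fun q => q.2 j) 0 p :=
  ⟨(EuclideanSpace.proj j).comp (ContinuousLinearMap.snd ℝ ℝ (EuclideanSpace ℝ (Fin 3))),
    ((EuclideanSpace.proj j).comp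
      (ContinuousLinearMap.snd ℝ ℝ (EuclideanSpace ℝ (Fin 3)))).hasFDerivAt, by simp⟩

theorem hasPartial_coord_succ (i j : Fin 3) (p : Spacetime) :
    HasPartial i.succ (fun q => q.2 j) (if i = j then 1 else 0) p :=
  ⟨(EuclideanSpace.proj j).comp (ContinuousLinearMap.snd ℝ ℝ (EuclideanSpace ℝ (Fin 3))),
    ((EuclideanSpace.proj j).comp
      (ContinuousLinearMap.snd ℝ ℝ (EuclideanSpace ℝ (Fin 3)))).hasFDerivAt, by
      simp [eq_comm]⟩

theorem norm_sq_eq_sum (x : EuclideanSpace ℝ (Fin 3)) : ‖x‖ ^ 2 = ∑ i, x i ^ 2 := by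
  simp [EuclideanSpace.norm_sq_eq]

/-- The `i`-th component of the unit radial vector `x / r`. -/
def omega (i : Fin 3) (p : Spacetime) : ℝ := p.2 i / ‖p.2‖

theorem sum_omega_sq {p : Spacetime} (hp : p.2 ≠ 0) : ∑ i, omega i p ^ 2 = 1 := by
  simp only [omega, div_pow, ← Finset.sum_div]
  rw [← norm_sq_eq_sum, div_self]
  exact pow_ne_zero 2 (norm_ne_zero_iff.2 hp)

theorem hasPartial_radius {α : Fin 4} {p : Spacetime} {x' : Fin 3 → ℝ} (hp : p.2 ≠ 0)
    (hx : ∀ j, HasPartial α (fun q => q.2 j) (x' j) p) :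
    HasPartial α (fun q => ‖q.2‖) (∑ j, omega j p * x' j) p := by
  have hr : (0 : ℝ) < ‖p.2‖ := norm_pos_iff.2 hp
  have h1 : HasPartial α (fun q => ∑ j, q.2 j ^ 2) (∑ j, 2 * p.2 j * x' j) p :=
    HasPartial.sum fun j _ => (hx j).sq
  have h2 : HasDerivAt Real.sqrt (1 / (2 * √(∑ j, p.2 j ^ 2))) (∑ j, p.2 j ^ 2) := by
    apply Real.hasDerivAt_sqrt
    rw [← norm_sq_eq_sum]
    positivity
  have h3 := HasPartial.comp (g := fun q : Spacetime => ∑ j, q.2 j ^ 2) h2 h1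
  simp only [← norm_sq_eq_sum, Real.sqrt_sq (norm_nonneg _)] at h3
  refine h3.congr_deriv ?_
  rw [Finset.mul_sum]
  refine Finset.sum_congr rfl fun j _ => ?_
  rw [omega]
  field_simp

theorem hasPartial_radius_zero {p : Spacetime} (hp : p.2 ≠ 0) :
    HasPartial 0 (fun q => ‖q.2‖) 0 p :=
  (hasPartial_radius hp fun j => hasPartial_coord_zero j p).congr_deriv (by simp)

theorem hasPartial_radius_succ (i : Fin 3) {p : Spacetime} (hp : p.2 ≠ 0) :
    HasPartial i.succ (fun q => ‖q.2‖) (omega i p) p :=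
  (hasPartial_radius hp fun j => hasPartial_coord_succ i j p).congr_deriv (by simp)

theorem hasPartial_inv_radius_zero {p : Spacetime} (hp : p.2 ≠ 0) :
    HasPartial 0 (fun q => ‖q.2‖⁻¹) 0 p :=
  (HasPartial.comp (g := fun q : Spacetime => ‖q.2‖) (hasDerivAt_inv (norm_ne_zero_iff.2 hp))
    (hasPartial_radius_zero hp)).congr_deriv (by simp)

theorem hasPartial_inv_radius_succ (i : Fin 3) {p : Spacetime} (hp : p.2 ≠ 0) :
    HasPartial i.succ (fun q => ‖q.2‖⁻¹) (-(omega i p * ‖p.2‖⁻¹ ^ 2)) p :=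
  (HasPartial.comp (g := fun q : Spacetime => ‖q.2‖) (hasDerivAt_inv (norm_ne_zero_iff.2 hp))
    (hasPartial_radius_succ i hp)).congr_deriv (by rw [inv_pow]; ring)

theorem hasPartial_omega_zero (j : Fin 3) {p : Spacetime} (hp : p.2 ≠ 0) :
    HasPartial 0 (omega j) 0 p :=
  ((hasPartial_coord_zero j p).mul (hasPartial_inv_radius_zero hp)).congr_deriv (by simp)

theorem hasPartial_omega_succ (i j : Fin 3) {p : Spacetime} (hp : p.2 ≠ 0) :
    HasPartial i.succ (omega j)
      (((if i = j then 1 else 0) - omega i p * omega j p) * ‖p.2‖⁻¹) p :=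
  ((hasPartial_coord_succ i j p).mul (hasPartial_inv_radius_succ i hp)).congr_deriv (by
    rw [omega, omega]; ring)

/-- Second partial derivatives of a `C²` function commute. -/
theorem partialDeriv_comm {g : Spacetime → ℝ} (hg : ContDiff ℝ 2 g) (α β : Fin 4)
    (p : Spacetime) :
    partialDeriv α (partialDeriv β g) p = partialDeriv β (partialDeriv α g) p := by
  have hsymm : IsSymmSndFDerivAt ℝ g p :=
    hg.contDiffAt.isSymmSndFDerivAt (by simp)
  have hd : DifferentiableAt ℝ (fderiv ℝ g) p :=
    (hg.fderiv_right (m := 1) (by norm_num)).differentiable (by norm_num) p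
  have key : ∀ α β : Fin 4, partialDeriv α (partialDeriv β g) p
      = fderiv ℝ (fderiv ℝ g) p (coordVec α) (coordVec β) := by
    intro α β
    have : HasFDerivAt (partialDeriv β g)
        ((fderiv ℝ (fderiv ℝ g) p).flip (coordVec β)) p := by
      have := hd.hasFDerivAt.clm_apply (hasFDerivAt_const (coordVec β) p)
      refine this.congr_fderiv ?_
      ext <;> simp
    rw [partialDeriv, this.fderiv]
    rfl
  rw [key, key]
  exact hsymm _ _

theorem contDiff_partialDeriv {g : Spacetime → ℝ} (hg : ContDiff ℝ 2 g) (α : Fin 4) :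
    ContDiff ℝ 1 (partialDeriv α g) :=
  (hg.fderiv_right (m := 1) (by norm_num)).clm_apply contDiff_const

theorem continuous_partialDeriv {F : Type*} [NormedAddCommGroup F] [NormedSpace ℝ F]
    {g : Spacetime → F} (hg : ContDiff ℝ 1 g) (α : Fin 4) :
    Continuous (partialDeriv α g) :=
  ((hg.fderiv_right (m := 0) (by norm_num)).clm_apply contDiff_const).continuous

theorem partialDeriv_eq_zero_of_notMem {F : Type*} [NormedAddCommGroup F] [NormedSpace ℝ F]
    {g : Spacetime → F} {p : Spacetime} (hp : p ∉ tsupport g) (α : Fin 4) :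
    partialDeriv α g p = 0 := by
  rw [partialDeriv, fderiv_of_notMem_tsupport ℝ hp, _root_.zero_apply]

theorem integrable_partialDeriv {g : Spacetime → ℝ} (hg : ContDiff ℝ 1 g)
    (hc : HasCompactSupport g) (α : Fin 4) : Integrable (partialDeriv α g) :=
  (continuous_partialDeriv hg α).integrable_of_hasCompactSupport
    (hc.fderiv_apply ℝ (coordVec α))

instance : (volume : Measure Spacetime).IsAddHaarMeasure :=
  inferInstanceAs ((volume : Measure ℝ).prod
    (volume : Measure (EuclideanSpace ℝ (Fin 3)))).IsAddHaarMeasure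

theorem integral_partialDeriv {g : Spacetime → ℝ} (hg : ContDiff ℝ 1 g)
    (hc : HasCompactSupport g) (α : Fin 4) : ∫ p, partialDeriv α g p = 0 := by
  have hint : Integrable (fun p => fderiv ℝ g p (coordVec α)) := integrable_partialDeriv hg hc α
  change ∫ p, fderiv ℝ g p (coordVec α) = 0
  have h := integral_mul_fderiv_eq_neg_fderiv_mul_of_integrable (μ := (volume : Measure Spacetime))
    (f := fun _ => (1 : ℝ)) (g := g) (v := coordVec α) (by simp)
    (by simpa only [one_mul] using hint)
    (by simpa using hg.continuous.integrable_of_hasCompactSupport hc)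
    (fun x _ => differentiableAt_const _)
    (fun x _ => hg.differentiable (by norm_num) x)
  simpa only [one_mul, fderiv_const_apply, _root_.zero_apply, zero_mul, integral_zero,
    neg_zero] using h

/-- A function that is smooth near each point of its support is smooth. -/
theorem contDiff_of_contDiffAt_tsupport {n : WithTop ℕ∞} {F : Type*} [NormedAddCommGroup F]
    [NormedSpace ℝ F] {g : Spacetime → F} (h : ∀ p ∈ tsupport g, ContDiffAt ℝ n g p) :
    ContDiff ℝ n g := by
  rw [contDiff_iff_contDiffAt]
  intro p
  by_cases hp : p ∈ tsupport g
  · exact h p hp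
  · exact contDiffAt_const.congr_of_eventuallyEq (notMem_tsupport_iff_eventuallyEq.1 hp)

/-! ### The energy current and its divergence -/

/-- The radial derivative `∂_r g = ∑ᵢ (xᵢ / r) ∂ᵢ g`. -/
def radialDeriv (g : Spacetime → ℝ) (p : Spacetime) : ℝ :=
  ∑ i : Fin 3, omega i p * partialDeriv i.succ g p

/-- The derivative of `g` along the multiplier vector field `X = b(t) ∂_t + ∂_r`. -/
def mult (b : ℝ → ℝ) (g : Spacetime → ℝ) (p : Spacetime) : ℝ :=
  b p.1 * partialDeriv 0 g p + radialDeriv g p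

/-- The squared Euclidean length of the spatial gradient. -/
def gradSq (g : Spacetime → ℝ) (p : Spacetime) : ℝ :=
  ∑ i : Fin 3, partialDeriv i.succ g p ^ 2

/-- The Lagrangian density `(∂_t g)² - |∇g|² + q(t) g²` of `□ + q`. -/
def lagrangian (q : ℝ → ℝ) (g : Spacetime → ℝ) (p : Spacetime) : ℝ :=
  partialDeriv 0 g p ^ 2 - gradSq g p + q p.1 * g p ^ 2

/-- The components of the energy current of `□ + q` for the multiplier `h(t) X`: the contraction
of the stress tensor with `h X`. -/
def current (h b q : ℝ → ℝ) (g : Spacetime → ℝ) (α : Fin 4) (p : Spacetime) : ℝ :=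
  Fin.cases
    (1 / 2 * (h p.1 * b p.1) * lagrangian q g p - h p.1 * partialDeriv 0 g p * mult b g p)
    (fun i : Fin 3 => 1 / 2 * (h p.1 * omega i p) * lagrangian q g p
      + h p.1 * partialDeriv i.succ g p * mult b g p) α

theorem hasPartial_timeFun_zero {c : ℝ → ℝ} {c' : ℝ} {p : Spacetime}
    (hc : HasDerivAt c c' p.1) : HasPartial 0 (fun q => c q.1) c' p :=
  (HasPartial.comp (g := fun q : Spacetime => q.1) hc (hasPartial_time_zero p)).congr_deriv
    (mul_one _)

theorem hasPartial_timeFun_succ {c : ℝ → ℝ} {c' : ℝ} {p : Spacetime}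
    (hc : HasDerivAt c c' p.1) (i : Fin 3) : HasPartial i.succ (fun q => c q.1) 0 p :=
  (HasPartial.comp (g := fun q : Spacetime => q.1) hc (hasPartial_time_succ i p)).congr_deriv
    (mul_zero _)

section
variable {g : Spacetime → ℝ} {p : Spacetime} {h b q : ℝ → ℝ} {h' b' q' : ℝ}

theorem hasPartial_self (hg : ContDiff ℝ 2 g) (α : Fin 4) :
    HasPartial α g (partialDeriv α g p) p :=
  .of_differentiableAt (hg.differentiable (by norm_num) p)

theorem hasPartial_partialDeriv (hg : ContDiff ℝ 2 g) (α β : Fin 4) :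
    HasPartial α (partialDeriv β g) (partialDeriv α (partialDeriv β g) p) p :=
  .of_differentiableAt ((contDiff_partialDeriv hg β).differentiable (by norm_num) p)

theorem hasPartial_lagrangian (hg : ContDiff ℝ 2 g) {α : Fin 4} {qα : ℝ}
    (hq : HasPartial α (fun y => q y.1) qα p) :
    HasPartial α (lagrangian q g)
      (2 * partialDeriv 0 g p * partialDeriv α (partialDeriv 0 g) p
        - (∑ i : Fin 3, 2 * partialDeriv i.succ g p * partialDeriv α (partialDeriv i.succ g) p)
        + (qα * g p ^ 2 + q p.1 * (2 * g p * partialDeriv α g p))) p :=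
  ((hasPartial_partialDeriv hg α 0).sq.sub
    (HasPartial.sum fun i _ => (hasPartial_partialDeriv hg α i.succ).sq)).add
    (hq.mul (hasPartial_self hg α).sq)

theorem hasPartial_mult (hg : ContDiff ℝ 2 g) {α : Fin 4} {bα : ℝ} {wα : Fin 3 → ℝ}
    (hb : HasPartial α (fun y => b y.1) bα p) (hw : ∀ i, HasPartial α (omega i) (wα i) p) :
    HasPartial α (mult b g)
      (bα * partialDeriv 0 g p + b p.1 * partialDeriv α (partialDeriv 0 g) p
        + ∑ i : Fin 3, (wα i * partialDeriv i.succ g p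
            + omega i p * partialDeriv α (partialDeriv i.succ g) p)) p :=
  (hb.mul (hasPartial_partialDeriv hg α 0)).add
    (HasPartial.sum fun i _ => (hw i).mul (hasPartial_partialDeriv hg α i.succ))

/-- Divergence of the energy current. The first term is the multiplier `h X g` against the
operator that `□ + q` becomes after the substitution `g = r ψ`. -/
theorem div_current (hg : ContDiff ℝ 2 g) (hp : p.2 ≠ 0) (hh : HasDerivAt h h' p.1)
    (hb : HasDerivAt b b' p.1) (hq : HasDerivAt q q' p.1) :
    ∑ α, partialDeriv α (current h b q g α) p =
      h p.1 * (box g p - 2 * ‖p.2‖⁻¹ * radialDeriv g p + q p.1 * g p) * mult b g p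
      - (1 / 2 * (h' * b p.1 + h p.1 * b') * (gradSq g p - radialDeriv g p ^ 2)
        + (1 / 2 * (h' * b p.1 + h p.1 * b') - h p.1 * ‖p.2‖⁻¹)
          * (partialDeriv 0 g p ^ 2 + radialDeriv g p ^ 2)
        + (h' - 2 * h p.1 * b p.1 * ‖p.2‖⁻¹) * partialDeriv 0 g p * radialDeriv g p)
      + 1 / 2 * ((h' * b p.1 + h p.1 * b') * q p.1 + h p.1 * b p.1 * q'
          + 2 * h p.1 * q p.1 * ‖p.2‖⁻¹) * g p ^ 2 := by
  have h0 : partialDeriv 0 (current h b q g 0) p = _ :=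
    HasPartial.partialDeriv_eq <| HasPartial.sub
      ((((hasPartial_timeFun_zero hh).mul (hasPartial_timeFun_zero hb)).const_mul (1 / 2)).mul
        (hasPartial_lagrangian hg (hasPartial_timeFun_zero hq)))
      (((hasPartial_timeFun_zero hh).mul (hasPartial_partialDeriv hg 0 0)).mul
        (hasPartial_mult hg (hasPartial_timeFun_zero hb) fun i => hasPartial_omega_zero i hp))
  have hi : ∀ i : Fin 3, partialDeriv i.succ (current h b q g i.succ) p = _ := fun i =>
    HasPartial.partialDeriv_eq <| HasPartial.add
      ((((hasPartial_timeFun_succ hh i).mul (hasPartial_omega_succ i i hp)).const_mul (1 / 2)).mul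
        (hasPartial_lagrangian hg (hasPartial_timeFun_succ hq i)))
      (((hasPartial_timeFun_succ hh i).mul (hasPartial_partialDeriv hg i.succ i.succ)).mul
        (hasPartial_mult hg (hasPartial_timeFun_succ hb i)
          fun j => hasPartial_omega_succ i j hp))
  have hw := sum_omega_sq hp
  rw [Fin.sum_univ_succ, h0, Finset.sum_congr rfl fun i _ => hi i]
  have c1 := fun i : Fin 3 => partialDeriv_comm hg 0 i.succ p
  have c2 := fun i j : Fin 3 => partialDeriv_comm hg i.succ j.succ p
  have c10 := c2 1 0
  have c20 := c2 2 0
  have c21 := c2 2 1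
  simp only [lagrangian, mult, radialDeriv, gradSq, box, Fin.sum_univ_three, c1] at hw ⊢
  -- express everything through one ordering of the mixed derivatives, then use `|ω| = 1`
  rw [c10, c20, c21]
  simp only [Fin.isValue, Fin.reduceEq, if_true, if_false]
  generalize omega 0 p = w0 at *
  generalize omega 1 p = w1 at *
  generalize omega 2 p = w2 at *
  generalize ‖p.2‖⁻¹ = ρ at *
  have hw' : w2 ^ 2 = 1 - w0 ^ 2 - w1 ^ 2 := by linarith
  ring_nf
  simp only [hw']
  ring

end

/-! ### Coercivity of the bulk terms -/

/-- Positivity of the coefficient of the angular derivatives, which comes from the derivative of the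
correction `t^{-1/2}` in `h`. In the next lemmas `σ = t^{-1/2}`, `a = t^{-1-δ}`, `e = t^{-2-δ}` and
`ρ = 1/r`. -/
theorem coercive_angular {σ a e δ : ℝ} (hσ : 0 < σ) (hσ1 : σ ≤ 1 / 100)
    (ha0 : 0 < a) (ha1 : a ≤ σ ^ 2) (hae : e = a * σ ^ 2) (hδ : 0 < δ)
    (hδ1 : δ < 1 / 2) :
    1 / 8 * σ ^ 3 ≤ -(1 / 2 * (-(1 / 2) * σ ^ 3 * (1 - a) + (1 + σ) * ((1 + δ) * e))) := by
  have he0 : 0 < e := by rw [hae]; positivity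
  have hσ2 : σ ^ 2 ≤ 1 / 10000 := by nlinarith
  have he1 : e ≤ σ ^ 2 * σ ^ 2 := by rw [hae]; gcongr
  have hσ4 : σ ^ 2 * σ ^ 2 ≤ 1 / 100 * σ ^ 3 := by
    calc σ ^ 2 * σ ^ 2 = σ * σ ^ 3 := by ring
      _ ≤ _ := by gcongr
  have h4 : (1 + σ) * (1 + δ) * e ≤ 101 / 100 * (3 / 2) * e := by gcongr <;> linarith
  have h5 : σ ^ 3 * a ≤ σ ^ 3 * (1 / 10000) := by gcongr; linarith
  have h6 : 0 < σ ^ 3 := by positivity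
  linarith

theorem coercive_zeroth {σ a e δ ρ : ℝ} (hσ : 0 < σ) (hσ1 : σ ≤ 1 / 100)
    (ha0 : 0 < a) (ha1 : a ≤ σ ^ 2) (hae : e = a * σ ^ 2) (hδ : 0 < δ) (hδ1 : δ < 1 / 2)
    (hρ : 99 / 100 * σ ^ 2 ≤ ρ) :
    6 / 10 * e ≤ (-(1 / 2) * σ ^ 3 * (1 - a) + (1 + σ) * ((1 + δ) * e)) * (1 - (1 - a) ^ 2)
      + (1 + σ) * (1 - a) * (-(2 * (1 - a) * ((1 + δ) * e)))
      + 2 * (1 + σ) * (1 - (1 - a) ^ 2) * ρ := by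
  have he0 : 0 < e := by rw [hae]; positivity
  have hσ2 : σ ^ 2 ≤ 1 / 10000 := by nlinarith
  have hq : 1 - (1 - a) ^ 2 = a * (2 - a) := by ring
  have hq0 : 0 ≤ a * (2 - a) := mul_nonneg ha0.le (by linarith)
  have t1 : -(1 / 10 * e) ≤ -(1 / 2) * σ ^ 3 * (1 - a) * (a * (2 - a)) := by
    have h2 : (1 - a) * (2 - a) ≤ 2 := by nlinarith
    have h3 : σ ^ 3 * a = σ * e := by rw [hae]; ring
    have h4 : σ * e ≤ 1 / 100 * e := by gcongr
    have h5 : σ * e * ((1 - a) * (2 - a)) ≤ σ * e * 2 := by gcongr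
    calc -(1 / 10 * e) ≤ -(1 / 2) * (σ * e * ((1 - a) * (2 - a))) := by linarith
      _ = _ := by rw [← h3]; ring
  have t2 : 0 ≤ (1 + σ) * ((1 + δ) * e) * (a * (2 - a)) := by positivity
  have t3 : (1 + σ) * (1 - a) * (2 * (1 - a) * ((1 + δ) * e)) ≤ 303 / 100 * e := by
    have h4 : (1 + σ) * (1 + δ) ≤ 101 / 100 * (3 / 2) := by gcongr <;> linarith
    have h5 : (1 - a) ^ 2 ≤ 1 := by nlinarith
    calc (1 + σ) * (1 - a) * (2 * (1 - a) * ((1 + δ) * e))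
        = 2 * ((1 + σ) * (1 + δ)) * (1 - a) ^ 2 * e := by ring
      _ ≤ 2 * (101 / 100 * (3 / 2)) * 1 * e := by gcongr
      _ = _ := by ring
  have t4 : 395 / 100 * e ≤ 2 * (1 + σ) * (a * (2 - a)) * ρ := by
    calc 395 / 100 * e ≤ 2 * 1 * (a * (2 - 1 / 1000)) * (99 / 100 * σ ^ 2) := by
          rw [hae]; linarith [mul_pos ha0 (pow_pos hσ 2)]
      _ ≤ _ := by gcongr <;> linarith
  rw [hq]
  linarith

theorem coercive_radial {σ a e δ ρ : ℝ} (P Y : ℝ) (hσ : 0 < σ) (hσ1 : σ ≤ 1 / 100)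
    (ha0 : 0 < a) (ha1 : a ≤ σ ^ 2) (hae : e = a * σ ^ 2) (hδ : 0 < δ) (hδ1 : δ < 1 / 2)
    (hρ : 99 / 100 * σ ^ 2 ≤ ρ) (hρ1 : ρ ≤ 102 / 100 * σ ^ 2) :
    1 / 2 * σ ^ 2 * (P + Y) ^ 2 + 3 / 10 * e * Y ^ 2 ≤
      -((1 / 2 * (-(1 / 2) * σ ^ 3 * (1 - a) + (1 + σ) * ((1 + δ) * e)) - (1 + σ) * ρ)
          * (P ^ 2 + Y ^ 2)
        + (-(1 / 2) * σ ^ 3 - 2 * (1 + σ) * (1 - a) * ρ) * P * Y) := by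
  have he0 : 0 < e := by rw [hae]; positivity
  have hσ2 : σ ^ 2 ≤ 1 / 10000 := by nlinarith
  have he2 : e ≤ 1 / 10000 * σ ^ 2 := by rw [hae]; gcongr; linarith
  -- `κ` is minus the time derivative of `h a`; `m` is the coefficient of `Y²` in the form in
  -- `P + Y` and `Y`
  obtain ⟨κ, hκ⟩ : ∃ κ, κ = 1 / 2 * σ ^ 3 * a + (1 + σ) * (1 + δ) * e := ⟨_, rfl⟩
  obtain ⟨m, hm⟩ : ∃ m, m = 2 * (1 + σ) * a * ρ - κ := ⟨_, rfl⟩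
  have hid : -((1 / 2 * (-(1 / 2) * σ ^ 3 * (1 - a) + (1 + σ) * ((1 + δ) * e)) - (1 + σ) * ρ)
        * (P ^ 2 + Y ^ 2) + (-(1 / 2) * σ ^ 3 - 2 * (1 + σ) * (1 - a) * ρ) * P * Y)
      = ((1 + σ) * ρ + 1 / 4 * σ ^ 3 - 1 / 2 * κ) * (P + Y) ^ 2
        + m * (Y ^ 2 - (P + Y) * Y) := by
    rw [hm, hκ]; ring
  have hκ1 : κ ≤ 153 / 100 * e := by
    have h1 : σ ^ 3 * a = σ * e := by rw [hae]; ring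
    have h2 : σ * e ≤ 1 / 100 * e := by gcongr
    have h3 : (1 + σ) * (1 + δ) * e ≤ 101 / 100 * (3 / 2) * e := by gcongr <;> linarith
    linarith
  have hκ0 : e ≤ κ := by
    have h1 : 0 ≤ 1 / 2 * σ ^ 3 * a := by positivity
    have h2 : 1 * 1 * e ≤ (1 + σ) * (1 + δ) * e := by gcongr <;> linarith
    linarith
  have hm0 : 4 / 10 * e ≤ m := by
    have : 198 / 100 * e ≤ 2 * (1 + σ) * a * ρ := by
      calc 198 / 100 * e = 2 * 1 * a * (99 / 100 * σ ^ 2) := by rw [hae]; ring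
        _ ≤ _ := by gcongr; linarith
    linarith
  have hm1 : m ≤ 11 / 10 * e := by
    have : 2 * (1 + σ) * a * ρ ≤ 207 / 100 * e := by
      calc 2 * (1 + σ) * a * ρ ≤ 2 * (1 + 1 / 100) * a * (102 / 100 * σ ^ 2) := by
            have : 0 ≤ ρ := le_trans (by positivity) hρ
            gcongr
        _ ≤ _ := by rw [hae]; linarith [mul_pos ha0 (pow_pos hσ 2)]
    linarith
  have hL : 9 / 10 * σ ^ 2 ≤ (1 + σ) * ρ + 1 / 4 * σ ^ 3 - 1 / 2 * κ := by
    have h1 : 1 * ρ ≤ (1 + σ) * ρ := by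
      gcongr
      · exact le_trans (by positivity) hρ
      · linarith
    have h2 : 0 < σ ^ 3 := by positivity
    linarith [pow_pos hσ 2]
  have hy : 3 / 4 * Y ^ 2 - (P + Y) ^ 2 ≤ Y ^ 2 - (P + Y) * Y := by
    linarith [sq_nonneg (Y / 2 - (P + Y))]
  have b1 := mul_le_mul_of_nonneg_right hL (sq_nonneg (P + Y))
  have b2 := mul_le_mul_of_nonneg_left hy (by linarith : 0 ≤ m)
  have b3 := mul_le_mul_of_nonneg_right hm0 (sq_nonneg Y)
  have b4 := mul_le_mul_of_nonneg_right hm1 (sq_nonneg (P + Y))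
  have b5 := mul_le_mul_of_nonneg_right he2 (sq_nonneg (P + Y))
  have b6 : 0 ≤ σ ^ 2 * (P + Y) ^ 2 := by positivity
  rw [hid]
  linarith

/-- The bulk terms of `div_current` for `h = 1 + t^{-1/2}`, `b = 1 - t^{-1-δ}` and
`q = τ² (1 - b²)`, written with `σ = t^{-1/2}`, `A = t^{-δ}`, `ρ = 1/r`, control the outgoing
derivative `P + Y`, the radial derivative `Y`, the angular derivatives `S` and `u`.
The correction `t^{-1/2}` in `h` makes the coefficient of `S` positive. -/
theorem coercive_bulk {σ A δ ρ S : ℝ} (τ P Y u : ℝ) (hσ : 0 < σ) (hσ1 : σ ≤ 1 / 100)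
    (hA : 0 < A) (hA1 : A ≤ 1) (hδ : 0 < δ) (hδ1 : δ < 1 / 2)
    (hρ : 99 / 100 * σ ^ 2 ≤ ρ) (hρ1 : ρ ≤ 102 / 100 * σ ^ 2) (hS : 0 ≤ S) :
    1 / 8 * σ ^ 3 * S + 1 / 2 * σ ^ 2 * (P + Y) ^ 2 + 3 / 10 * (A * σ ^ 4) * Y ^ 2
        + 3 / 10 * τ ^ 2 * (A * σ ^ 4) * u ^ 2 ≤
      1 / 2 * ((-(1 / 2) * σ ^ 3 * (1 - A * σ ^ 2) + (1 + σ) * ((1 + δ) * (A * σ ^ 4)))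
              * (τ ^ 2 * (1 - (1 - A * σ ^ 2) ^ 2))
            + (1 + σ) * (1 - A * σ ^ 2)
              * (-(2 * τ ^ 2 * (1 - A * σ ^ 2) * ((1 + δ) * (A * σ ^ 4))))
            + 2 * (1 + σ) * (τ ^ 2 * (1 - (1 - A * σ ^ 2) ^ 2)) * ρ) * u ^ 2
      - (1 / 2 * (-(1 / 2) * σ ^ 3 * (1 - A * σ ^ 2) + (1 + σ) * ((1 + δ) * (A * σ ^ 4))) * S
        + (1 / 2 * (-(1 / 2) * σ ^ 3 * (1 - A * σ ^ 2) + (1 + σ) * ((1 + δ) * (A * σ ^ 4)))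
            - (1 + σ) * ρ) * (P ^ 2 + Y ^ 2)
        + (-(1 / 2) * σ ^ 3 - 2 * (1 + σ) * (1 - A * σ ^ 2) * ρ) * P * Y) := by
  obtain ⟨a, ha⟩ : ∃ a, a = A * σ ^ 2 := ⟨_, rfl⟩
  obtain ⟨e, he⟩ : ∃ e, e = A * σ ^ 4 := ⟨_, rfl⟩
  have hae : e = a * σ ^ 2 := by rw [ha, he]; ring
  have ha0 : 0 < a := by rw [ha]; positivity
  have ha1 : a ≤ σ ^ 2 := by rw [ha]; exact mul_le_of_le_one_left (by positivity) hA1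
  rw [← ha, ← he]
  have h1 := mul_le_mul_of_nonneg_right (coercive_angular hσ hσ1 ha0 ha1 hae hδ hδ1) hS
  have h2 := mul_le_mul_of_nonneg_right (coercive_zeroth hσ hσ1 ha0 ha1 hae hδ hδ1 hρ)
    (by positivity : 0 ≤ 1 / 2 * (τ ^ 2 * u ^ 2))
  have h3 := coercive_radial P Y hσ hσ1 ha0 ha1 hae hδ hδ1 hρ hρ1
  linarith

/-! ### The conjugated operator -/

/-- The time component `b = 1 - t^{-1-δ}` of the gradient field `X = b ∂_t + ∂_r` of the
weight `f_δ`. -/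
def gradTime (δ t : ℝ) : ℝ := 1 - t ^ (-1 - δ)

theorem hasDerivAt_gradTime (δ : ℝ) {t : ℝ} (ht : 0 < t) :
    HasDerivAt (gradTime δ) ((1 + δ) * (t ^ (-1 - δ) * t⁻¹)) t := by
  have h := (Real.hasDerivAt_rpow_const (p := -1 - δ) (Or.inl ht.ne')).const_sub 1
  refine h.congr_deriv ?_
  rw [Real.rpow_sub_one ht.ne' (-1 - δ)]
  ring

/-- The factor `g = e^{-τ (f_δ - R')} / r`, so that `e^{-τ (f_δ - R')} ψ = g (r ψ)`. -/
def conjFactor (τ δ R' : ℝ) (p : Spacetime) : ℝ :=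
  Real.exp (-(τ * (weight δ p - R'))) * ‖p.2‖⁻¹

theorem hasPartial_conjFactor {α : Fin 4} {f' ρ' : ℝ} (τ δ R' : ℝ) {p : Spacetime}
    (hf : HasPartial α (weight δ) f' p) (hρ : HasPartial α (fun q => ‖q.2‖⁻¹) ρ' p) :
    HasPartial α (conjFactor τ δ R')
      (Real.exp (-(τ * (weight δ p - R'))) * (-τ * f' * ‖p.2‖⁻¹ + ρ')) p := by
  have hc : HasDerivAt (fun x : ℝ => Real.exp (-(τ * (x - R'))))
      (Real.exp (-(τ * (weight δ p - R'))) * -τ) (weight δ p) := by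
    have := (((hasDerivAt_id (weight δ p)).sub_const R').const_mul τ).neg.exp
    simpa using this
  exact ((HasPartial.comp hc hf).mul hρ).congr_deriv (by ring)

theorem hasPartial_weight_zero {δ : ℝ} (hδ : δ ≠ 0) {p : Spacetime} (ht : 0 < p.1)
    (hp : p.2 ≠ 0) : HasPartial 0 (weight δ) (-gradTime δ p.1) p := by
  have hc : HasDerivAt (fun t : ℝ => δ⁻¹ * t ^ (-δ)) (δ⁻¹ * (-δ * p.1 ^ (-δ - 1))) p.1 :=
    (Real.hasDerivAt_rpow_const (Or.inl ht.ne')).const_mul _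
  refine (((hasPartial_radius_zero hp).sub (hasPartial_time_zero p)).sub
    (hasPartial_timeFun_zero hc)).congr_deriv ?_
  rw [gradTime, show -δ - 1 = -1 - δ by ring]
  field_simp
  ring

theorem hasPartial_weight_succ {δ : ℝ} (i : Fin 3) {p : Spacetime} (ht : 0 < p.1)
    (hp : p.2 ≠ 0) : HasPartial i.succ (weight δ) (omega i p) p := by
  have hc : HasDerivAt (fun t : ℝ => δ⁻¹ * t ^ (-δ)) (δ⁻¹ * (-δ * p.1 ^ (-δ - 1))) p.1 :=
    (Real.hasDerivAt_rpow_const (Or.inl ht.ne')).const_mul _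
  exact (((hasPartial_radius_succ i hp).sub (hasPartial_time_succ i p)).sub
    (hasPartial_timeFun_succ hc i)).congr_deriv (by ring)

theorem hasPartial_conjFactor_zero {δ : ℝ} (hδ : δ ≠ 0) (τ R' : ℝ) {p : Spacetime}
    (ht : 0 < p.1) (hp : p.2 ≠ 0) :
    HasPartial 0 (conjFactor τ δ R') (conjFactor τ δ R' p * (τ * gradTime δ p.1)) p :=
  (hasPartial_conjFactor τ δ R' (hasPartial_weight_zero hδ ht hp)
    (hasPartial_inv_radius_zero hp)).congr_deriv (by rw [conjFactor]; ring)

theorem hasPartial_conjFactor_succ (i : Fin 3) (τ δ R' : ℝ) {p : Spacetime}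
    (ht : 0 < p.1) (hp : p.2 ≠ 0) :
    HasPartial i.succ (conjFactor τ δ R')
      (conjFactor τ δ R' p * -((τ + ‖p.2‖⁻¹) * omega i p)) p :=
  (hasPartial_conjFactor τ δ R' (hasPartial_weight_succ i ht hp)
    (hasPartial_inv_radius_succ i hp)).congr_deriv (by rw [conjFactor]; ring)

theorem isOpen_future_off_axis : IsOpen {p : Spacetime | 0 < p.1 ∧ p.2 ≠ 0} :=
  (isOpen_lt continuous_const continuous_fst).inter
    (isOpen_ne_fun continuous_snd continuous_const)

section
variable {G m g : Spacetime → ℝ} {m' : ℝ} {α : Fin 4} {p : Spacetime} {U : Set Spacetime}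

/-- Leibniz rule for a factor `G` with logarithmic derivative `m`. -/
theorem partialDeriv_factor_mul (hg : ContDiff ℝ 2 g) (hG : HasPartial α G (G p * m p) p) :
    HasPartial α (fun q => G q * g q) (G p * (partialDeriv α g p + m p * g p)) p :=
  (hG.mul (hasPartial_self hg α)).congr_deriv (by ring)

/-- If `∂_α G = G m` near `p`, then
`∂_α² (G g) = G (∂_α² g + 2 m ∂_α g + (m² + ∂_α m) g)` at `p`. -/
theorem second_partialDeriv_factor_mul (hg : ContDiff ℝ 2 g) (hU : IsOpen U) (hp : p ∈ U)
    (hG : ∀ q ∈ U, HasPartial α G (G q * m q) q) (hm : HasPartial α m m' p) :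
    partialDeriv α (partialDeriv α fun q => G q * g q) p =
      G p * (partialDeriv α (partialDeriv α g) p + 2 * m p * partialDeriv α g p
        + (m p ^ 2 + m') * g p) := by
  have hev : (partialDeriv α fun q => G q * g q)
      =ᶠ[𝓝 p] fun q => G q * (partialDeriv α g q + m q * g q) := by
    filter_upwards [hU.mem_nhds hp] with q hq
    exact (partialDeriv_factor_mul hg (hG q hq)).partialDeriv_eq
  have h := ((hG p hp).mul
    ((hasPartial_partialDeriv hg α α).add (hm.mul (hasPartial_self hg α)))).congr_of_eventuallyEq
      hev
  rw [h.partialDeriv_eq]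
  ring

end

/-- The effect of the conjugation on the wave operator. All terms of order `1/r` in the zeroth
order coefficient cancel, which is the reason for the factor `1/r`. -/
theorem box_conjFactor_mul {δ : ℝ} (hδ : δ ≠ 0) (τ R' : ℝ) {g : Spacetime → ℝ}
    (hg : ContDiff ℝ 2 g) {p : Spacetime} (ht : 0 < p.1) (hp : p.2 ≠ 0) :
    box (fun q => conjFactor τ δ R' q * g q) p = conjFactor τ δ R' p *
      (box g p - 2 * ‖p.2‖⁻¹ * radialDeriv g p - 2 * τ * mult (gradTime δ) g p
        + τ ^ 2 * (1 - gradTime δ p.1 ^ 2) * g p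
        - τ * ((1 + δ) * (p.1 ^ (-1 - δ) * p.1⁻¹)) * g p) := by
  have hmem : p ∈ {p : Spacetime | 0 < p.1 ∧ p.2 ≠ 0} := ⟨ht, hp⟩
  have h0 := second_partialDeriv_factor_mul (m := fun q => τ * gradTime δ q.1) hg
    isOpen_future_off_axis hmem
    (fun q hq => hasPartial_conjFactor_zero hδ τ R' hq.1 hq.2)
    ((hasPartial_timeFun_zero (hasDerivAt_gradTime δ ht)).const_mul τ)
  have hi : ∀ i : Fin 3, _ := fun i =>
    second_partialDeriv_factor_mul (m := fun q => -1 * ((τ + ‖q.2‖⁻¹) * omega i q)) hg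
      isOpen_future_off_axis hmem
      (fun q hq => (hasPartial_conjFactor_succ i τ δ R' hq.1 hq.2).congr_deriv (by ring))
      (((HasPartial.add (f := fun _ => τ) (f' := 0) ⟨0, hasFDerivAt_const τ p, rfl⟩
        (hasPartial_inv_radius_succ i hp)).mul (hasPartial_omega_succ i i hp)).const_mul (-1))
  have hw := sum_omega_sq hp
  rw [box, h0, Finset.sum_congr rfl fun i _ => hi i]
  simp only [box, mult, radialDeriv, Fin.sum_univ_three, if_true] at hw ⊢
  generalize omega 0 p = w0 at *
  generalize omega 1 p = w1 at *
  generalize omega 2 p = w2 at *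
  have hw' : w2 ^ 2 = 1 - w0 ^ 2 - w1 ^ 2 := by linarith
  ring_nf
  simp only [hw']
  ring

/-- The function `r ψ^I`. -/
def scaled {N : ℕ} (ψ : Spacetime → EuclideanSpace ℝ (Fin N)) (I : Fin N) (p : Spacetime) : ℝ :=
  ‖p.2‖ * ψ p I

theorem conj_eq_conjFactor_mul {N : ℕ} (τ δ R' : ℝ) (ψ : Spacetime → EuclideanSpace ℝ (Fin N))
    (I : Fin N) {p : Spacetime} (hp : p.2 ≠ 0) :
    (Real.exp (-(τ * (weight δ p - R'))) • ψ p) I = conjFactor τ δ R' p * scaled ψ I p := by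
  have : ‖p.2‖ ≠ 0 := norm_ne_zero_iff.2 hp
  rw [conjFactor, scaled, PiLp.smul_apply, smul_eq_mul]
  field_simp

/-- The contribution of the lower order coefficients to `r` times the conjugated operator, sorted
by the outgoing derivative `∂_t + ∂_r`, the radial and the angular derivatives of `r ψ`. -/
def perturbation {N : ℕ} (V : Fin N → Fin N → Fin 4 → Spacetime → ℝ)
    (W : Fin N → Fin N → Spacetime → ℝ) (τ δ : ℝ) (u : Fin N → Spacetime → ℝ) (I : Fin N)
    (p : Spacetime) : ℝ :=
  ∑ J, (V I J 0 p * (partialDeriv 0 (u J) p + radialDeriv (u J) p)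
    + (∑ i : Fin 3, V I J i.succ p
      * (partialDeriv i.succ (u J) p - omega i p * radialDeriv (u J) p))
    - V I J 0 p * (τ * p.1 ^ (-1 - δ) + ‖p.2‖⁻¹) * u J p
    + (∑ α, V I J α p * omegaHat p α) * (radialDeriv (u J) p - (τ + ‖p.2‖⁻¹) * u J p)
    + W I J p * u J p)

theorem omegaHat_zero (p : Spacetime) : omegaHat p 0 = -1 := rfl

theorem omegaHat_succ (p : Spacetime) (i : Fin 3) : omegaHat p i.succ = omega i p := rfl

theorem box_congr {f g : Spacetime → ℝ} {p : Spacetime} (h : f =ᶠ[𝓝 p] g) :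
    box f p = box g p := by
  have h2 : ∀ α, partialDeriv α (partialDeriv α f) p = partialDeriv α (partialDeriv α g) p := by
    intro α
    have : partialDeriv α f =ᶠ[𝓝 p] partialDeriv α g := by
      filter_upwards [h.fderiv (𝕜 := ℝ)] with q hq
      rw [partialDeriv, partialDeriv, hq]
    rw [partialDeriv, partialDeriv, this.fderiv_eq]
  simp only [box, h2]

/-- The conjugated operator, multiplied by `r` and written in terms of the functions `r ψ^J`. -/
theorem radius_mul_conjWaveOp {N : ℕ} (V : Fin N → Fin N → Fin 4 → Spacetime → ℝ)
    (W : Fin N → Fin N → Spacetime → ℝ) {δ : ℝ} (hδ : δ ≠ 0) (τ R' : ℝ)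
    (ψ : Spacetime → EuclideanSpace ℝ (Fin N)) (hψ : ∀ J, ContDiff ℝ 2 (scaled ψ J))
    {p : Spacetime} (ht : 0 < p.1) (hp : p.2 ≠ 0) (I : Fin N) :
    ‖p.2‖ * conjWaveOp V W τ δ R' ψ p I =
      box (scaled ψ I) p - 2 * ‖p.2‖⁻¹ * radialDeriv (scaled ψ I) p
        - 2 * τ * mult (gradTime δ) (scaled ψ I) p
        + τ ^ 2 * (1 - gradTime δ p.1 ^ 2) * scaled ψ I p
        - τ * ((1 + δ) * (p.1 ^ (-1 - δ) * p.1⁻¹)) * scaled ψ I p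
        + perturbation V W τ δ (scaled ψ) I p := by
  have hev : ∀ J, (fun q => (Real.exp (-(τ * (weight δ q - R'))) • ψ q) J)
      =ᶠ[𝓝 p] fun q => conjFactor τ δ R' q * scaled ψ J q := by
    intro J
    filter_upwards [isOpen_future_off_axis.mem_nhds ⟨ht, hp⟩] with q hq
    exact conj_eq_conjFactor_mul τ δ R' ψ J hq.2
  have hV : ∀ J, ∑ α, V I J α p *
      partialDeriv α (fun q => (Real.exp (-(τ * (weight δ q - R'))) • ψ q) J) p
      = conjFactor τ δ R' p * (V I J 0 p *
          (partialDeriv 0 (scaled ψ J) p + τ * gradTime δ p.1 * scaled ψ J p)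
        + ∑ i : Fin 3, V I J i.succ p * (partialDeriv i.succ (scaled ψ J) p
          + -((τ + ‖p.2‖⁻¹) * omega i p) * scaled ψ J p)) := by
    intro J
    have e : ∀ α, partialDeriv α
        (fun q => (Real.exp (-(τ * (weight δ q - R'))) • ψ q) J) p
        = partialDeriv α (fun q => conjFactor τ δ R' q * scaled ψ J q) p := by
      intro α
      rw [partialDeriv, partialDeriv, (hev J).fderiv_eq]
    simp only [e]
    rw [Fin.sum_univ_succ, (partialDeriv_factor_mul (m := fun q => τ * gradTime δ q.1) (hψ J)
        (hasPartial_conjFactor_zero hδ τ R' ht hp)).partialDeriv_eq,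
      mul_add (conjFactor τ δ R' p) (V I J 0 p * _), Finset.mul_sum]
    congr 1
    · ring
    · refine Finset.sum_congr rfl fun i _ => ?_
      rw [(partialDeriv_factor_mul (m := fun q => -((τ + ‖q.2‖⁻¹) * omega i q)) (hψ J)
        (hasPartial_conjFactor_succ i τ δ R' ht hp)).partialDeriv_eq]
      ring
  have hunit : ‖p.2‖ * Real.exp (τ * (weight δ p - R')) * conjFactor τ δ R' p = 1 := by
    have : ‖p.2‖ ≠ 0 := norm_ne_zero_iff.2 hp
    rw [conjFactor, Real.exp_neg]
    field_simp
  have hwave : waveOp V W (fun q => Real.exp (-(τ * (weight δ q - R'))) • ψ q) p I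
      = conjFactor τ δ R' p * (box (scaled ψ I) p - 2 * ‖p.2‖⁻¹ * radialDeriv (scaled ψ I) p
        - 2 * τ * mult (gradTime δ) (scaled ψ I) p
        + τ ^ 2 * (1 - gradTime δ p.1 ^ 2) * scaled ψ I p
        - τ * ((1 + δ) * (p.1 ^ (-1 - δ) * p.1⁻¹)) * scaled ψ I p
        + perturbation V W τ δ (scaled ψ) I p) := by
    change box (fun q => (Real.exp (-(τ * (weight δ q - R'))) • ψ q) I) p
      + (∑ J, ∑ α, V I J α p *
          partialDeriv α (fun q => (Real.exp (-(τ * (weight δ q - R'))) • ψ q) J) p)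
      + (∑ J, W I J p * (Real.exp (-(τ * (weight δ p - R'))) • ψ p) J) = _
    rw [box_congr (hev I), box_conjFactor_mul hδ τ R' (hψ I) ht hp,
      Finset.sum_congr rfl fun J _ => hV J, add_assoc, ← Finset.sum_add_distrib, mul_add,
      perturbation, Finset.mul_sum]
    congr 1
    refine Finset.sum_congr rfl fun J _ => ?_
    rw [conj_eq_conjFactor_mul τ δ R' ψ J hp, Fin.sum_univ_succ (n := 3)]
    simp only [omegaHat_zero, omegaHat_succ, Fin.sum_univ_three, gradTime]
    ring
  rw [conjWaveOp, PiLp.smul_apply, smul_eq_mul, hwave, ← mul_assoc, ← mul_assoc, hunit, one_mul]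

/-! ### The pointwise Carleman inequality -/

/-- The quadratic form controlled by the energy identity; here `σ = t^{-1/2}` and `A = t^{-δ}`. -/
def bulk (σ A τ : ℝ) (u : Spacetime → ℝ) (p : Spacetime) : ℝ :=
  1 / 8 * σ ^ 3 * (gradSq u p - radialDeriv u p ^ 2)
    + 1 / 2 * σ ^ 2 * (partialDeriv 0 u p + radialDeriv u p) ^ 2
    + 3 / 10 * (A * σ ^ 4) * radialDeriv u p ^ 2 + 3 / 10 * τ ^ 2 * (A * σ ^ 4) * u p ^ 2

/-- The energy current used for the Carleman estimate. -/
def carlemanCurrent (τ δ : ℝ) (u : Spacetime → ℝ) : Fin 4 → Spacetime → ℝ :=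
  current (fun t => 1 + t ^ (-(1 / 2) : ℝ)) (gradTime δ)
    (fun t => τ ^ 2 * (1 - gradTime δ t ^ 2)) u

theorem sum_angular_sq (u : Spacetime → ℝ) {p : Spacetime} (hp : p.2 ≠ 0) :
    ∑ i : Fin 3, (partialDeriv i.succ u p - omega i p * radialDeriv u p) ^ 2
      = gradSq u p - radialDeriv u p ^ 2 := by
  have hw := sum_omega_sq hp
  simp only [gradSq, radialDeriv, Fin.sum_univ_three] at hw ⊢
  have hw' : omega 2 p ^ 2 = 1 - omega 0 p ^ 2 - omega 1 p ^ 2 := by linarith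
  ring_nf
  simp only [hw']
  have e3 : omega 2 p ^ 3 = (1 - omega 0 p ^ 2 - omega 1 p ^ 2) * omega 2 p := by
    rw [← hw']; ring
  have e4 : omega 2 p ^ 4 = (1 - omega 0 p ^ 2 - omega 1 p ^ 2) ^ 2 := by
    rw [← hw']; ring
  simp only [e3, e4]
  ring

/-- The energy identity and coercivity combined: `bulk` is controlled by the square of the conjugated
operator (without perturbation) and the divergence of the current. -/
theorem bulk_le {σ A δ τ : ℝ} {u : Spacetime → ℝ} (hu : ContDiff ℝ 2 u) {p : Spacetime}
    (ht : 0 < p.1) (hp : p.2 ≠ 0) (hσ : σ = p.1 ^ (-(1 / 2) : ℝ)) (hA : A = p.1 ^ (-δ))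
    (hσ1 : σ ≤ 1 / 100) (hA1 : A ≤ 1) (hδ : 0 < δ) (hδ1 : δ < 1 / 2) (hτ : 0 ≤ τ)
    (hρ : 99 / 100 * σ ^ 2 ≤ ‖p.2‖⁻¹) (hρ1 : ‖p.2‖⁻¹ ≤ 102 / 100 * σ ^ 2) :
    2 * τ * bulk σ A τ u p ≤
      1 / 2 * (box u p - 2 * ‖p.2‖⁻¹ * radialDeriv u p - 2 * τ * mult (gradTime δ) u p
        + τ ^ 2 * (1 - gradTime δ p.1 ^ 2) * u p) ^ 2
      + 2 * τ * ∑ α, partialDeriv α (carlemanCurrent τ δ u α) p := by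
  have hσ0 : 0 < σ := hσ ▸ Real.rpow_pos_of_pos ht _
  have hA0 : 0 < A := hA ▸ Real.rpow_pos_of_pos ht _
  have htσ : p.1⁻¹ = σ ^ 2 := by
    rw [hσ, ← Real.rpow_natCast, ← Real.rpow_mul ht.le, ← Real.rpow_neg_one]
    norm_num
  have ha : p.1 ^ (-1 - δ) = A * σ ^ 2 := by
    rw [hA, ← htσ, ← Real.rpow_neg_one, ← Real.rpow_add ht]
    ring_nf
  have hb : gradTime δ p.1 = 1 - A * σ ^ 2 := by rw [gradTime, ha]
  have hh : HasDerivAt (fun t : ℝ => 1 + t ^ (-(1 / 2) : ℝ)) (-(1 / 2) * σ ^ 3) p.1 := by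
    refine ((Real.hasDerivAt_rpow_const (Or.inl ht.ne')).const_add 1).congr_deriv ?_
    rw [Real.rpow_sub_one ht.ne', ← hσ, div_eq_mul_inv σ, htσ]
    ring
  have hb' : HasDerivAt (gradTime δ) ((1 + δ) * (A * σ ^ 4)) p.1 := by
    refine (hasDerivAt_gradTime δ ht).congr_deriv ?_
    rw [ha, htσ]
    ring
  have hq' : HasDerivAt (fun t => τ ^ 2 * (1 - gradTime δ t ^ 2))
      (-(2 * τ ^ 2 * (1 - A * σ ^ 2) * ((1 + δ) * (A * σ ^ 4)))) p.1 := by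
    refine (((hb'.pow 2).const_sub 1).const_mul (τ ^ 2)).congr_deriv ?_
    rw [hb]
    push_cast
    ring
  have hdiv := div_current hu hp hh hb' hq'
  have hS : 0 ≤ gradSq u p - radialDeriv u p ^ 2 := by
    rw [← sum_angular_sq u hp]
    exact Finset.sum_nonneg fun i _ => sq_nonneg _
  have hco := coercive_bulk (δ := δ) τ (partialDeriv 0 u p) (radialDeriv u p) (u p) hσ0 hσ1 hA0 hA1
    hδ hδ1 hρ hρ1 hS
  rw [carlemanCurrent, hdiv, bulk, hb, ← hσ]
  have hτco := mul_le_mul_of_nonneg_left hco (by positivity : 0 ≤ 2 * τ)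
  refine hτco.trans ?_
  generalize hG : box u p - 2 * ‖p.2‖⁻¹ * radialDeriv u p - 2 * τ * mult (gradTime δ) u p
        + τ ^ 2 * (1 - (1 - A * σ ^ 2) ^ 2) * u p = G
  have hG' : box u p - 2 * ‖p.2‖⁻¹ * radialDeriv u p + τ ^ 2 * (1 - (1 - A * σ ^ 2) ^ 2) * u p
      = G + 2 * τ * mult (gradTime δ) u p := by rw [← hG]; ring
  rw [hG']
  generalize mult (gradTime δ) u p = X
  -- completing the square absorbs the product of `G` and the multiplier
  have h1 : 0 ≤ (1 + σ) * (1 / 2 * G + 2 * τ * X) ^ 2 := by positivity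
  have h2 : (1 + σ) * (1 / 4 * G ^ 2) ≤ 1 / 2 * G ^ 2 := by
    have : (1 + σ) * (1 / 4 * G ^ 2) ≤ (1 + 1) * (1 / 4 * G ^ 2) := by gcongr; linarith
    linarith
  linarith

/-- Absorption of the lower order terms. The numbers `l`, `s`, `y`, `n` bound the outgoing, angular
and radial derivatives and the function; `c σ²` and `c σ² g` bound the coefficients. -/
theorem perturbation_absorbed {σ A g τ ρ c l s y n : ℝ} (hσ : 0 < σ) (hσ1 : σ ≤ 1 / 100)
    (hσA : σ ≤ A) (hA1 : A ≤ 1) (hg : 0 ≤ g) (hgA : g ≤ A) (hτ : 1 ≤ τ) (hρ0 : 0 ≤ ρ)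
    (hρ1 : ρ ≤ 102 / 100 * σ ^ 2) (hc : 0 ≤ c) (hcσ : c ^ 2 * σ ≤ 1 / 1000)
    (hcg : c ^ 2 * g ≤ 1 / 1000) (hl : 0 ≤ l) (hs : 0 ≤ s) (hy : 0 ≤ y) (hn : 0 ≤ n) :
    3 / 2 * (c * σ ^ 2 * (l + s + (τ * (A * σ ^ 2) + ρ) * n)
        + c * (σ ^ 2 * g) * (y + (τ + ρ + 1) * n)) ^ 2 ≤
      1 / 8 * σ ^ 3 * s ^ 2 + 1 / 2 * σ ^ 2 * l ^ 2 + 3 / 10 * (A * σ ^ 4) * y ^ 2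
        + 2 / 10 * τ ^ 2 * (A * σ ^ 4) * n ^ 2 := by
  have hA0 : 0 < A := hσ.trans_le hσA
  have hσ2 : σ ^ 2 ≤ 1 / 10000 := by nlinarith
  have h1 : τ * (A * σ ^ 2) + ρ ≤ 3 * τ * σ ^ 2 := by
    have : τ * (A * σ ^ 2) ≤ τ * (1 * σ ^ 2) := by gcongr
    have : 1 * σ ^ 2 ≤ τ * σ ^ 2 := by gcongr
    linarith [pow_pos hσ 2]
  have h2 : τ + ρ + 1 ≤ 3 * τ := by linarith
  have h3 : c * σ ^ 2 * (l + s + (τ * (A * σ ^ 2) + ρ) * n)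
        + c * (σ ^ 2 * g) * (y + (τ + ρ + 1) * n)
      ≤ c * σ ^ 2 * (l + s + g * y + 3 * τ * σ ^ 2 * n + 3 * τ * g * n) := by
    calc _ ≤ c * σ ^ 2 * (l + s + 3 * τ * σ ^ 2 * n)
        + c * (σ ^ 2 * g) * (y + 3 * τ * n) := by gcongr
      _ = _ := by ring
  -- Cauchy-Schwarz for five summands
  have h4 : ∀ a b d e f : ℝ, (a + b + d + e + f) ^ 2
      ≤ 5 * (a ^ 2 + b ^ 2 + d ^ 2 + e ^ 2 + f ^ 2) := fun a b d e f => by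
    linarith [sq_nonneg (a - b), sq_nonneg (a - d), sq_nonneg (a - e), sq_nonneg (a - f),
      sq_nonneg (b - d), sq_nonneg (b - e), sq_nonneg (b - f), sq_nonneg (d - e),
      sq_nonneg (d - f), sq_nonneg (e - f)]
  have h5 : (c * σ ^ 2 * (l + s + (τ * (A * σ ^ 2) + ρ) * n)
        + c * (σ ^ 2 * g) * (y + (τ + ρ + 1) * n)) ^ 2
      ≤ c ^ 2 * σ ^ 4 * (5 * (l ^ 2 + s ^ 2 + (g * y) ^ 2 + (3 * τ * σ ^ 2 * n) ^ 2
        + (3 * τ * g * n) ^ 2)) := by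
    calc _ ≤ (c * σ ^ 2 * (l + s + g * y + 3 * τ * σ ^ 2 * n + 3 * τ * g * n)) ^ 2 := by
          gcongr
      _ = c ^ 2 * σ ^ 4 * (l + s + g * y + 3 * τ * σ ^ 2 * n + 3 * τ * g * n) ^ 2 := by ring
      _ ≤ _ := by gcongr; exact h4 _ _ _ _ _
  have k1 : c ^ 2 * σ ^ 4 * l ^ 2 ≤ 1 / 1000 * (σ ^ 2 * l ^ 2) := by
    calc c ^ 2 * σ ^ 4 * l ^ 2 = (c ^ 2 * σ) * σ * (σ ^ 2 * l ^ 2) := by ring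
      _ ≤ 1 / 1000 * 1 * (σ ^ 2 * l ^ 2) := by gcongr; linarith
      _ = _ := by ring
  have k2 : c ^ 2 * σ ^ 4 * s ^ 2 ≤ 1 / 1000 * (σ ^ 3 * s ^ 2) := by
    calc c ^ 2 * σ ^ 4 * s ^ 2 = (c ^ 2 * σ) * (σ ^ 3 * s ^ 2) := by ring
      _ ≤ 1 / 1000 * (σ ^ 3 * s ^ 2) := by gcongr
  have k3 : c ^ 2 * σ ^ 4 * (g * y) ^ 2 ≤ 1 / 1000 * (A * σ ^ 4 * y ^ 2) := by
    calc c ^ 2 * σ ^ 4 * (g * y) ^ 2 = (c ^ 2 * g) * (g * σ ^ 4 * y ^ 2) := by ring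
      _ ≤ 1 / 1000 * (A * σ ^ 4 * y ^ 2) := by gcongr
  have k4 : c ^ 2 * σ ^ 4 * (3 * τ * σ ^ 2 * n) ^ 2
      ≤ 9 / 10000000 * (τ ^ 2 * (A * σ ^ 4) * n ^ 2) := by
    calc c ^ 2 * σ ^ 4 * (3 * τ * σ ^ 2 * n) ^ 2
        = 9 * (c ^ 2 * σ) * (σ ^ 2) * (τ ^ 2 * (σ * σ ^ 4) * n ^ 2) := by ring
      _ ≤ 9 * (1 / 1000) * (1 / 10000) * (τ ^ 2 * (A * σ ^ 4) * n ^ 2) := by gcongr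
      _ = _ := by ring
  have k5 : c ^ 2 * σ ^ 4 * (3 * τ * g * n) ^ 2
      ≤ 9 / 1000 * (τ ^ 2 * (A * σ ^ 4) * n ^ 2) := by
    calc c ^ 2 * σ ^ 4 * (3 * τ * g * n) ^ 2
        = 9 * (c ^ 2 * g) * (τ ^ 2 * (g * σ ^ 4) * n ^ 2) := by ring
      _ ≤ 9 * (1 / 1000) * (τ ^ 2 * (A * σ ^ 4) * n ^ 2) := by gcongr
      _ = _ := by ring
  have n1 : 0 ≤ σ ^ 2 * l ^ 2 := by positivity
  have n2 : 0 ≤ σ ^ 3 * s ^ 2 := by positivity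
  have n3 : 0 ≤ A * σ ^ 4 * y ^ 2 := by positivity
  have n4 : 0 ≤ τ ^ 2 * (A * σ ^ 4) * n ^ 2 := by positivity
  linarith

/-- The perturbation in terms of the coefficient sums of `CoeffBounds`, given bounds `l`, `s`, `y`,
`n` for the outgoing, angular and radial derivatives and for the functions. -/
theorem abs_perturbation_le {N : ℕ} (V : Fin N → Fin N → Fin 4 → Spacetime → ℝ)
    (W : Fin N → Fin N → Spacetime → ℝ) {τ δ l s y n : ℝ} (u : Fin N → Spacetime → ℝ)
    (I : Fin N) {p : Spacetime} (ht : 0 < p.1) (hτ : 0 ≤ τ)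
    (hl : ∀ J, |partialDeriv 0 (u J) p + radialDeriv (u J) p| ≤ l)
    (hs : ∀ J, ∀ i : Fin 3,
      |partialDeriv i.succ (u J) p - omega i p * radialDeriv (u J) p| ≤ s)
    (hy : ∀ J, |radialDeriv (u J) p| ≤ y) (hn : ∀ J, |u J p| ≤ n)
    (hl0 : 0 ≤ l) (hs0 : 0 ≤ s) (hy0 : 0 ≤ y) (hn0 : 0 ≤ n) :
    |perturbation V W τ δ u I p| ≤
      (∑ J, ∑ α, |V I J α p|) * (l + s + (τ * p.1 ^ (-1 - δ) + ‖p.2‖⁻¹) * n)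
      + ((∑ J, |∑ α, V I J α p * omegaHat p α|) + ∑ J, |W I J p|)
        * (y + (τ + ‖p.2‖⁻¹ + 1) * n) := by
  rw [← Finset.sum_add_distrib, Finset.sum_mul, Finset.sum_mul, ← Finset.sum_add_distrib,
    perturbation]
  refine (Finset.abs_sum_le_sum_abs _ _).trans (Finset.sum_le_sum fun J _ => ?_)
  rw [Fin.sum_univ_succ (fun α => |V I J α p|)]
  generalize ∑ α, V I J α p * omegaHat p α = v
  have ha : 0 ≤ τ * p.1 ^ (-1 - δ) + ‖p.2‖⁻¹ := by positivity
  have hρ : 0 ≤ ‖p.2‖⁻¹ := by positivity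
  generalize τ * p.1 ^ (-1 - δ) + ‖p.2‖⁻¹ = a at ha
  generalize ‖p.2‖⁻¹ = ρ at hρ
  have e1 : |V I J 0 p * (partialDeriv 0 (u J) p + radialDeriv (u J) p)| ≤ |V I J 0 p| * l := by
    rw [abs_mul]; gcongr; exact hl J
  have e2 : |∑ i : Fin 3, V I J i.succ p
      * (partialDeriv i.succ (u J) p - omega i p * radialDeriv (u J) p)|
      ≤ (∑ i : Fin 3, |V I J i.succ p|) * s := by
    rw [Finset.sum_mul]
    refine (Finset.abs_sum_le_sum_abs _ _).trans (Finset.sum_le_sum fun i _ => ?_)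
    rw [abs_mul]; gcongr; exact hs J i
  have e3 : |V I J 0 p * a * u J p| ≤ |V I J 0 p| * a * n := by
    rw [abs_mul, abs_mul, abs_of_nonneg ha]; gcongr; exact hn J
  have e4 : |v * (radialDeriv (u J) p - (τ + ρ) * u J p)| ≤ |v| * (y + (τ + ρ) * n) := by
    rw [abs_mul]
    gcongr
    refine (abs_sub _ _).trans ?_
    rw [abs_mul, abs_of_nonneg (by positivity : 0 ≤ τ + ρ)]
    gcongr
    exacts [hy J, hn J]
  have e5 : |W I J p * u J p| ≤ |W I J p| * n := by
    rw [abs_mul]; gcongr; exact hn J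
  have hsum : 0 ≤ ∑ i : Fin 3, |V I J i.succ p| := Finset.sum_nonneg fun i _ => abs_nonneg _
  have f1 : 0 ≤ |V I J 0 p| * s := by positivity
  have f2 : 0 ≤ (∑ i : Fin 3, |V I J i.succ p|) * (l + a * n) := by positivity
  have f3 : 0 ≤ |v| * n := by positivity
  have f4 : 0 ≤ |W I J p| * (y + (τ + ρ) * n) := by positivity
  refine (abs_add_le _ _).trans ?_
  refine (add_le_add_left (abs_add_le _ _) _).trans ?_
  refine (add_le_add_left (add_le_add_left (abs_sub _ _) _) _).trans ?_
  refine (add_le_add_left (add_le_add_left (add_le_add_left (abs_add_le _ _) _) _) _).trans ?_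
  linarith

section
variable {N : ℕ} {ψ : Spacetime → EuclideanSpace ℝ (Fin N)}

theorem tsupport_scaled_subset (J : Fin N) : tsupport (scaled ψ J) ⊆ tsupport ψ := by
  refine closure_mono fun p hp => ?_
  contrapose! hp
  have : ψ p = 0 := by simpa using hp
  simp [scaled, this]

theorem contDiff_scaled (hψ : ContDiff ℝ 2 ψ) (hs : ∀ p ∈ tsupport ψ, p.2 ≠ 0) (J : Fin N) :
    ContDiff ℝ 2 (scaled ψ J) := by
  refine contDiff_of_contDiffAt_tsupport fun p hp => ?_
  have hp2 := hs p (tsupport_scaled_subset J hp)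
  exact (contDiffAt_snd.norm ℝ hp2).mul (contDiff_euclidean.1 hψ J).contDiffAt

theorem partialDeriv_zero_scaled (hψ : ContDiff ℝ 2 ψ) {p : Spacetime} (hp : p.2 ≠ 0)
    (J : Fin N) : partialDeriv 0 (scaled ψ J) p = ‖p.2‖ * partialDeriv 0 ψ p J := by
  have hd := (hψ.differentiable (by norm_num) p).hasFDerivAt
  have h : HasPartial 0 (fun q => ψ q J) (partialDeriv 0 ψ p J) p :=
    ⟨(EuclideanSpace.proj J).comp (fderiv ℝ ψ p),
      (EuclideanSpace.proj (𝕜 := ℝ) J).hasFDerivAt.comp p hd, rfl⟩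
  rw [show scaled ψ J = fun q => ‖q.2‖ * ψ q J from rfl,
    ((hasPartial_radius_zero hp).mul h).partialDeriv_eq]
  ring

end

theorem le_sqrt_sum_sq {ι : Type*} [Fintype ι] (f : ι → ℝ) (i : ι) :
    |f i| ≤ √(∑ j, f j ^ 2) := by
  apply Real.abs_le_sqrt
  exact Finset.single_le_sum (f := fun j => f j ^ 2) (fun j _ => sq_nonneg _) (Finset.mem_univ i)

/-- The pointwise form of the Carleman inequality: up to a divergence, the conjugated operator
controls `ψ` and `∂_t ψ`. The hypotheses on `t` express that it is large, uniformly in `δ`. -/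
theorem pointwise_carleman {N : ℕ} {V : Fin N → Fin N → Fin 4 → Spacetime → ℝ}
    {W : Fin N → Fin N → Spacetime → ℝ} {ψ : Spacetime → EuclideanSpace ℝ (Fin N)}
    {c γ δ τ R' : ℝ} {Ω : Set Spacetime} {p : Spacetime} (hc : 0 ≤ c) (hVW : CoeffBounds V W c γ Ω)
    (hpΩ : p ∈ Ω) (hψ : ContDiff ℝ 2 ψ) (hs : ∀ J, ContDiff ℝ 2 (scaled ψ J))
    (hγ : 0 < γ) (hδ : 0 < δ) (hδγ : δ < γ) (hδ1 : δ < 1 / 2) (hτ : 1 ≤ τ)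
    (ht : 1 ≤ p.1) (hr : |‖p.2‖ - p.1| ≤ 1 / 100 * p.1)
    (ht1 : p.1 ^ (-(1 / 2) : ℝ) ≤ 1 / 100) (ht2 : c ^ 2 * p.1 ^ (-(1 / 2) : ℝ) ≤ 1 / 1000)
    (ht3 : c ^ 2 * p.1 ^ (-γ) ≤ 1 / 1000) :
    τ * ((‖partialDeriv 0 ψ p‖ ^ 2 + (τ * ‖ψ p‖) ^ 2) * p.1 ^ (-δ)) ≤
      28 * (‖conjWaveOp V W τ δ R' ψ p‖ ^ 2 * p.1 ^ 2)
      + 28 * τ * ∑ J, ∑ α, partialDeriv α (carlemanCurrent τ δ (scaled ψ J) α) p := by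
  have ht0 : 0 < p.1 := by linarith
  obtain ⟨hr1, hr2⟩ := abs_le.1 hr
  have hr0 : 0 < ‖p.2‖ := by linarith
  have hp : p.2 ≠ 0 := norm_pos_iff.1 hr0
  obtain ⟨σ, hσ⟩ : ∃ σ, σ = p.1 ^ (-(1 / 2) : ℝ) := ⟨_, rfl⟩
  obtain ⟨A, hA⟩ : ∃ A, A = p.1 ^ (-δ) := ⟨_, rfl⟩
  obtain ⟨g, hg⟩ : ∃ g, g = p.1 ^ (-γ) := ⟨_, rfl⟩
  obtain ⟨ρ, hρ⟩ : ∃ ρ, ρ = ‖p.2‖⁻¹ := ⟨_, rfl⟩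
  have hσ0 : 0 < σ := hσ ▸ Real.rpow_pos_of_pos ht0 _
  have hA0 : 0 < A := hA ▸ Real.rpow_pos_of_pos ht0 _
  have hg0 : 0 < g := hg ▸ Real.rpow_pos_of_pos ht0 _
  have hρ0 : 0 < ρ := hρ ▸ inv_pos.2 hr0
  have hσA : σ ≤ A := by
    rw [hσ, hA]; exact Real.rpow_le_rpow_of_exponent_le ht (by linarith)
  have hgA : g ≤ A := by
    rw [hg, hA]; exact Real.rpow_le_rpow_of_exponent_le ht (by linarith)
  have hA1 : A ≤ 1 := by
    rw [hA]; exact Real.rpow_le_one_of_one_le_of_nonpos ht (by linarith)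
  have htσ : p.1⁻¹ = σ ^ 2 := by
    rw [hσ, ← Real.rpow_natCast, ← Real.rpow_mul ht0.le, ← Real.rpow_neg_one]
    norm_num
  have ha : p.1 ^ (-1 - δ) = A * σ ^ 2 := by
    rw [hA, ← htσ, ← Real.rpow_neg_one, ← Real.rpow_add ht0]
    ring_nf
  rw [← hσ] at ht1 ht2
  rw [← hg] at ht3
  have hρ1 : 99 / 100 * σ ^ 2 ≤ ρ := by
    rw [← htσ, hρ, ← div_eq_mul_inv, ← one_div, div_le_div_iff₀ ht0 hr0]
    linarith
  have hρ2 : ρ ≤ 102 / 100 * σ ^ 2 := by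
    rw [← htσ, hρ, ← div_eq_mul_inv, ← one_div, div_le_div_iff₀ hr0 ht0]
    linarith
  have hσ2 : σ ^ 2 ≤ 1 / 10000 := by nlinarith
  -- the sums over the components
  obtain ⟨L2, hL2⟩ : ∃ x, x = ∑ J, (partialDeriv 0 (scaled ψ J) p
    + radialDeriv (scaled ψ J) p) ^ 2 := ⟨_, rfl⟩
  obtain ⟨S2, hS2⟩ : ∃ x, x = ∑ J, (gradSq (scaled ψ J) p - radialDeriv (scaled ψ J) p ^ 2) :=
    ⟨_, rfl⟩
  obtain ⟨Y2, hY2⟩ : ∃ x, x = ∑ J, radialDeriv (scaled ψ J) p ^ 2 := ⟨_, rfl⟩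
  obtain ⟨n2, hn2⟩ : ∃ x, x = ∑ J, scaled ψ J p ^ 2 := ⟨_, rfl⟩
  have hSJ : ∀ J, 0 ≤ gradSq (scaled ψ J) p - radialDeriv (scaled ψ J) p ^ 2 := fun J => by
    rw [← sum_angular_sq _ hp]; exact Finset.sum_nonneg fun i _ => sq_nonneg _
  have hL0 : 0 ≤ L2 := hL2 ▸ Finset.sum_nonneg fun J _ => sq_nonneg _
  have hS0 : 0 ≤ S2 := hS2 ▸ Finset.sum_nonneg fun J _ => hSJ J
  have hY0 : 0 ≤ Y2 := hY2 ▸ Finset.sum_nonneg fun J _ => sq_nonneg _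
  have hn0 : 0 ≤ n2 := hn2 ▸ Finset.sum_nonneg fun J _ => sq_nonneg _
  -- the coefficients
  have hw : 0 < 1 + p.1 + ‖p.2‖ := by linarith
  have hV : (∑ I, ∑ J, ∑ α, |V I J α p|) ≤ c * σ ^ 2 := by
    refine (hVW.1 p hpΩ).trans ?_
    rw [← htσ, ← Real.rpow_neg_one p.1]
    gcongr ?_ * ?_
    exact Real.rpow_le_rpow_of_nonpos ht0 (by linarith) (by norm_num)
  have hW : (∑ I, ∑ J, |∑ α, V I J α p * omegaHat p α|) + (∑ I, ∑ J, |W I J p|)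
      ≤ c * (σ ^ 2 * g) := by
    refine (hVW.2 p hpΩ).trans ?_
    rw [← htσ, ← Real.rpow_neg_one p.1, hg, ← Real.rpow_add ht0, ← sub_eq_add_neg]
    gcongr ?_ * ?_
    exact Real.rpow_le_rpow_of_nonpos ht0 (by linarith) (by linarith)
  have hD : 3 / 2 * ∑ I, perturbation V W τ δ (scaled ψ) I p ^ 2 ≤
      1 / 8 * σ ^ 3 * S2 + 1 / 2 * σ ^ 2 * L2 + 3 / 10 * (A * σ ^ 4) * Y2
        + 2 / 10 * τ ^ 2 * (A * σ ^ 4) * n2 := by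
    have hab := perturbation_absorbed (τ := τ) hσ0 ht1 hσA hA1 hg0.le hgA hτ hρ0.le hρ2 hc ht2 ht3
      (Real.sqrt_nonneg L2) (Real.sqrt_nonneg S2) (Real.sqrt_nonneg Y2) (Real.sqrt_nonneg n2)
    rw [Real.sq_sqrt hL0, Real.sq_sqrt hS0, Real.sq_sqrt hY0, Real.sq_sqrt hn0] at hab
    refine le_trans ?_ hab
    refine mul_le_mul_of_nonneg_left ?_ (by norm_num)
    have hI : ∀ I, |perturbation V W τ δ (scaled ψ) I p| ≤ _ := fun I =>
      abs_perturbation_le (δ := δ) V W (scaled ψ) I ht0 (by linarith : 0 ≤ τ)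
        (fun J => hL2 ▸ le_sqrt_sum_sq (fun J => partialDeriv 0 (scaled ψ J) p
          + radialDeriv (scaled ψ J) p) J)
        (s := √S2) (fun J i => by
          apply Real.abs_le_sqrt
          rw [hS2]
          refine le_trans ?_ (Finset.single_le_sum (fun J _ => hSJ J) (Finset.mem_univ J))
          rw [← sum_angular_sq _ hp]
          exact Finset.single_le_sum (f := fun i : Fin 3 =>
            (partialDeriv i.succ (scaled ψ J) p - omega i p * radialDeriv (scaled ψ J) p) ^ 2)
            (fun i _ => sq_nonneg _) (Finset.mem_univ i))
        (fun J => hY2 ▸ le_sqrt_sum_sq (fun J => radialDeriv (scaled ψ J) p) J)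
        (fun J => hn2 ▸ le_sqrt_sum_sq (fun J => scaled ψ J p) J)
        (Real.sqrt_nonneg _) (Real.sqrt_nonneg _) (Real.sqrt_nonneg _) (Real.sqrt_nonneg _)
    calc ∑ I, perturbation V W τ δ (scaled ψ) I p ^ 2
        = ∑ I, |perturbation V W τ δ (scaled ψ) I p| ^ 2 := by simp only [sq_abs]
      _ ≤ (∑ I, |perturbation V W τ δ (scaled ψ) I p|) ^ 2 :=
          Finset.sum_sq_le_sq_sum_of_nonneg fun _ _ => abs_nonneg _
      _ ≤ _ := by
          refine pow_le_pow_left₀ (Finset.sum_nonneg fun _ _ => abs_nonneg _) ?_ 2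
          refine (Finset.sum_le_sum fun I _ => hI I).trans ?_
          rw [Finset.sum_add_distrib, ← Finset.sum_mul, ← Finset.sum_mul, Finset.sum_add_distrib,
            ha, ← hρ]
          gcongr
  -- the energy identity, summed over the components
  have hB : 2 * τ * (1 / 8 * σ ^ 3 * S2 + 1 / 2 * σ ^ 2 * L2 + 3 / 10 * (A * σ ^ 4) * Y2
        + 3 / 10 * τ ^ 2 * (A * σ ^ 4) * n2) ≤
      3 / 2 * (‖p.2‖ ^ 2 * ‖conjWaveOp V W τ δ R' ψ p‖ ^ 2)
      + 3 / 2 * (τ * ((1 + δ) * (A * σ ^ 4))) ^ 2 * n2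
      + 3 / 2 * ∑ I, perturbation V W τ δ (scaled ψ) I p ^ 2
      + 2 * τ * ∑ J, ∑ α, partialDeriv α (carlemanCurrent τ δ (scaled ψ J) α) p := by
    have e1 : 2 * τ * (1 / 8 * σ ^ 3 * S2 + 1 / 2 * σ ^ 2 * L2 + 3 / 10 * (A * σ ^ 4) * Y2
        + 3 / 10 * τ ^ 2 * (A * σ ^ 4) * n2) = ∑ J, 2 * τ * bulk σ A τ (scaled ψ J) p := by
      rw [hS2, hL2, hY2, hn2]
      simp only [bulk, ← Finset.mul_sum, Finset.sum_add_distrib]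
    have e2 : ‖conjWaveOp V W τ δ R' ψ p‖ ^ 2 = ∑ J, conjWaveOp V W τ δ R' ψ p J ^ 2 := by
      simp [EuclideanSpace.norm_sq_eq]
    rw [e1, e2, hn2]
    simp only [Finset.mul_sum (Finset.univ : Finset (Fin N)), ← Finset.sum_add_distrib]
    refine Finset.sum_le_sum fun J _ => ?_
    refine (bulk_le (hs J) ht0 hp hσ hA ht1 hA1 hδ hδ1 (by linarith) (hρ ▸ hρ1)
      (hρ ▸ hρ2)).trans ?_
    have hC := radius_mul_conjWaveOp V W hδ.ne' τ R' ψ hs ht0 hp J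
    rw [ha, htσ] at hC
    generalize box (scaled ψ J) p - 2 * ‖p.2‖⁻¹ * radialDeriv (scaled ψ J) p
        - 2 * τ * mult (gradTime δ) (scaled ψ J) p
        + τ ^ 2 * (1 - gradTime δ p.1 ^ 2) * scaled ψ J p = G at hC ⊢
    have hG : G = ‖p.2‖ * conjWaveOp V W τ δ R' ψ p J
        + τ * ((1 + δ) * (A * σ ^ 4)) * scaled ψ J p
        + -perturbation V W τ δ (scaled ψ) J p := by rw [hC]; ring
    have h3 : ∀ x y z : ℝ, 1 / 2 * (x + y + z) ^ 2 ≤ 3 / 2 * (x ^ 2 + y ^ 2 + z ^ 2) :=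
      fun x y z => by linarith [sq_nonneg (x - y), sq_nonneg (x - z), sq_nonneg (y - z)]
    refine (add_le_add_left (hG ▸ h3 _ _ _) _).trans (le_of_eq ?_)
    ring
  have hE : 3 / 2 * (τ * ((1 + δ) * (A * σ ^ 4))) ^ 2 * n2
      ≤ 1 / 10 * τ ^ 2 * (A * σ ^ 4) * n2 := by
    calc 3 / 2 * (τ * ((1 + δ) * (A * σ ^ 4))) ^ 2 * n2
        = 3 / 2 * (1 + δ) ^ 2 * (A * σ ^ 2 * σ ^ 2) * (τ ^ 2 * (A * σ ^ 4) * n2) := by ring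
      _ ≤ 3 / 2 * (1 + 1 / 2) ^ 2 * (1 * (1 / 10000) * (1 / 10000))
          * (τ ^ 2 * (A * σ ^ 4) * n2) := by gcongr
      _ ≤ 1 / 10 * (τ ^ 2 * (A * σ ^ 4) * n2) := by gcongr; norm_num
      _ = _ := by ring
  obtain ⟨Q, hQ⟩ : ∃ Q, Q = 1 / 8 * σ ^ 3 * S2 + 1 / 2 * σ ^ 2 * L2 + 3 / 10 * (A * σ ^ 4) * Y2
        + 3 / 10 * τ ^ 2 * (A * σ ^ 4) * n2 := ⟨_, rfl⟩
  have hQ0 : 0 ≤ Q := by rw [hQ]; positivity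
  have hτQ : 1 * Q ≤ τ * Q := by gcongr
  -- the left hand side in terms of the quadratic form
  have hlhs : (‖partialDeriv 0 ψ p‖ ^ 2 + (τ * ‖ψ p‖) ^ 2) * A ≤ 14 * Q := by
    have hρr : ρ * ‖p.2‖ = 1 := by rw [hρ]; exact inv_mul_cancel₀ hr0.ne'
    have f1 : ‖ψ p‖ ^ 2 = ρ ^ 2 * n2 := by
      rw [hn2, EuclideanSpace.norm_sq_eq, Finset.mul_sum]
      refine Finset.sum_congr rfl fun J _ => ?_
      rw [scaled, Real.norm_eq_abs, sq_abs, ← mul_pow, ← mul_assoc, hρr, one_mul]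
    have f2 : ‖partialDeriv 0 ψ p‖ ^ 2 ≤ ρ ^ 2 * (2 * L2 + 2 * Y2) := by
      rw [hL2, hY2, EuclideanSpace.norm_sq_eq, Finset.mul_sum, Finset.mul_sum,
        ← Finset.sum_add_distrib, Finset.mul_sum]
      refine Finset.sum_le_sum fun J _ => ?_
      have h := partialDeriv_zero_scaled hψ hp J
      have h' : partialDeriv 0 ψ p J = ρ * partialDeriv 0 (scaled ψ J) p := by
        rw [h, ← mul_assoc, hρr, one_mul]
      rw [Real.norm_eq_abs, sq_abs, h', mul_pow]
      gcongr
      linarith [sq_nonneg (partialDeriv 0 (scaled ψ J) p + 2 * radialDeriv (scaled ψ J) p)]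
    have f3 : ρ ^ 2 ≤ 2 * σ ^ 4 := by
      calc ρ ^ 2 ≤ (102 / 100 * σ ^ 2) ^ 2 := by gcongr
        _ = (102 / 100) ^ 2 * σ ^ 4 := by ring
        _ ≤ _ := by gcongr; norm_num
    calc (‖partialDeriv 0 ψ p‖ ^ 2 + (τ * ‖ψ p‖) ^ 2) * A
        ≤ (ρ ^ 2 * (2 * L2 + 2 * Y2) + τ ^ 2 * (ρ ^ 2 * n2)) * A := by
          rw [mul_pow, f1]; gcongr
      _ = ρ ^ 2 * ((2 * L2 + 2 * Y2 + τ ^ 2 * n2) * A) := by ring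
      _ ≤ 2 * σ ^ 4 * ((2 * L2 + 2 * Y2 + τ ^ 2 * n2) * A) := by gcongr
      _ = 4 * (σ ^ 2 * A) * (σ ^ 2 * L2) + 4 * (A * σ ^ 4 * Y2)
          + 2 * (τ ^ 2 * (A * σ ^ 4) * n2) := by ring
      _ ≤ 4 * (1 / 10000 * 1) * (σ ^ 2 * L2) + 4 * (A * σ ^ 4 * Y2)
          + 2 * (τ ^ 2 * (A * σ ^ 4) * n2) := by gcongr
      _ ≤ 14 * Q := by
          have g1 : 0 ≤ σ ^ 2 * L2 := by positivity
          have g2 : 0 ≤ A * σ ^ 4 * Y2 := by positivity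
          have g3 : 0 ≤ τ ^ 2 * (A * σ ^ 4) * n2 := by positivity
          have g4 : 0 ≤ σ ^ 3 * S2 := by positivity
          rw [hQ]
          linarith
  have hrt : ‖p.2‖ ^ 2 * ‖conjWaveOp V W τ δ R' ψ p‖ ^ 2
      ≤ (101 / 100 * p.1) ^ 2 * ‖conjWaveOp V W τ δ R' ψ p‖ ^ 2 := by gcongr; linarith
  have hpos : 0 ≤ p.1 ^ 2 * ‖conjWaveOp V W τ δ R' ψ p‖ ^ 2 := by positivity
  rw [← hQ] at hB
  have hτl := mul_le_mul_of_nonneg_left hlhs (by linarith : 0 ≤ τ)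
  rw [← hA]
  linarith

/-! ### Integration -/

section
variable {u : Spacetime → ℝ} {p : Spacetime}

theorem contDiffAt_omega {n : WithTop ℕ∞} (i : Fin 3) (hp : p.2 ≠ 0) :
    ContDiffAt ℝ n (omega i) p := by
  have h1 : ContDiff ℝ n fun q : Spacetime => q.2 i := contDiff_euclidean.1 contDiff_snd i
  exact h1.contDiffAt.div (contDiffAt_snd.norm ℝ hp) (norm_ne_zero_iff.2 hp)

theorem contDiffAt_radialDeriv (hu : ContDiff ℝ 2 u) (hp : p.2 ≠ 0) :
    ContDiffAt ℝ 1 (radialDeriv u) p :=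
  ContDiffAt.sum fun i _ =>
    (contDiffAt_omega i hp).mul (contDiff_partialDeriv hu i.succ).contDiffAt

theorem contDiffAt_timePow {n : WithTop ℕ∞} (s : ℝ) (ht : 0 < p.1) :
    ContDiffAt ℝ n (fun q : Spacetime => q.1 ^ s) p :=
  contDiffAt_fst.rpow_const_of_ne ht.ne'

theorem contDiffAt_gradTime {n : WithTop ℕ∞} (δ : ℝ) (ht : 0 < p.1) :
    ContDiffAt ℝ n (fun q : Spacetime => gradTime δ q.1) p :=
  contDiffAt_const.sub (contDiffAt_timePow _ ht)

theorem contDiffAt_mult (δ : ℝ) (hu : ContDiff ℝ 2 u) (ht : 0 < p.1) (hp : p.2 ≠ 0) :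
    ContDiffAt ℝ 1 (mult (gradTime δ) u) p :=
  ((contDiffAt_gradTime δ ht).mul (contDiff_partialDeriv hu 0).contDiffAt).add
    (contDiffAt_radialDeriv hu hp)

theorem contDiffAt_carlemanCurrent (τ δ : ℝ) (hu : ContDiff ℝ 2 u) (ht : 0 < p.1)
    (hp : p.2 ≠ 0) (α : Fin 4) : ContDiffAt ℝ 1 (carlemanCurrent τ δ u α) p := by
  have hP := fun β => (contDiff_partialDeriv hu β).contDiffAt (x := p)
  have hu1 : ContDiffAt ℝ 1 u p := (hu.of_le (by norm_num)).contDiffAt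
  have hh : ContDiffAt ℝ 1 (fun q : Spacetime => 1 + q.1 ^ (-(1 / 2) : ℝ)) p :=
    contDiffAt_const.add (contDiffAt_timePow _ ht)
  have hb := contDiffAt_gradTime (n := 1) δ ht
  have hX := contDiffAt_mult δ hu ht hp
  have hg : ContDiffAt ℝ 1 (gradSq u) p := ContDiffAt.sum fun i _ => (hP i.succ).pow 2
  have hE : ContDiffAt ℝ 1 (lagrangian (fun t => τ ^ 2 * (1 - gradTime δ t ^ 2)) u) p :=
    (((hP 0).pow 2).sub hg).add
      ((contDiffAt_const.mul (contDiffAt_const.sub (hb.pow 2))).mul (hu1.pow 2))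
  refine Fin.cases ?_ (fun i => ?_) α
  · exact ((contDiffAt_const.mul (hh.mul hb)).mul hE).sub ((hh.mul (hP 0)).mul hX)
  · exact ((contDiffAt_const.mul (hh.mul (contDiffAt_omega i hp))).mul hE).add
      ((hh.mul (hP i.succ)).mul hX)

theorem tsupport_carlemanCurrent_subset (τ δ : ℝ) (α : Fin 4) :
    tsupport (carlemanCurrent τ δ u α) ⊆ tsupport u := by
  refine closure_minimal (fun p hp => ?_) (isClosed_tsupport u)
  contrapose! hp
  have h0 : u p = 0 := image_eq_zero_of_notMem_tsupport hp
  have h1 := partialDeriv_eq_zero_of_notMem hp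
  rw [Function.notMem_support]
  refine Fin.cases ?_ (fun i => ?_) α <;>
  simp [carlemanCurrent, current, lagrangian, gradSq, mult, radialDeriv, h0, h1]

end

section
variable {N : ℕ} {V : Fin N → Fin N → Fin 4 → Spacetime → ℝ}
  {W : Fin N → Fin N → Spacetime → ℝ} {ψ : Spacetime → EuclideanSpace ℝ (Fin N)}

theorem conjWaveOp_eq_zero (τ δ R' : ℝ) {p : Spacetime} (hp : p ∉ tsupport ψ) :
    conjWaveOp V W τ δ R' ψ p = 0 := by
  have hev : ∀ J, (fun q => (Real.exp (-(τ * (weight δ q - R'))) • ψ q) J)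
      =ᶠ[𝓝 p] fun _ => (0 : ℝ) := by
    intro J
    filter_upwards [notMem_tsupport_iff_eventuallyEq.1 hp] with q hq
    simp [hq]
  have h1 : ∀ J α, partialDeriv α
      (fun q => (Real.exp (-(τ * (weight δ q - R'))) • ψ q) J) p = 0 := by
    intro J α
    rw [partialDeriv, (hev J).fderiv_eq]
    simp
  have h2 : ∀ J, box (fun q => (Real.exp (-(τ * (weight δ q - R'))) • ψ q) J) p = 0 := by
    intro J
    have h0 : ∀ α, partialDeriv α (fun _ : Spacetime => (0 : ℝ)) = fun _ => 0 := fun α => by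
      ext q
      simp [partialDeriv]
    rw [box_congr (hev J)]
    simp [box, h0]
  have h3 : ψ p = 0 := image_eq_zero_of_notMem_tsupport hp
  have : waveOp V W (fun q => Real.exp (-(τ * (weight δ q - R'))) • ψ q) p = 0 := by
    ext I
    simp only [waveOp, h1, h2, h3]
    simp
  rw [conjWaveOp, this, smul_zero]

theorem continuousOn_conjWaveOp {K : Set Spacetime} {δ : ℝ} (hδ : δ ≠ 0) (τ R' : ℝ)
    (hV : ∀ I J α, ContinuousOn (V I J α) K) (hW : ∀ I J, ContinuousOn (W I J) K)
    (hK : ∀ p ∈ K, 0 < p.1 ∧ p.2 ≠ 0) (hs : ∀ J, ContDiff ℝ 2 (scaled ψ J)) (I : Fin N) :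
    ContinuousOn (fun p => conjWaveOp V W τ δ R' ψ p I) K := by
  have hρ : ContinuousOn (fun p : Spacetime => ‖p.2‖⁻¹) K :=
    continuous_snd.norm.continuousOn.inv₀ fun p hp => norm_ne_zero_iff.2 (hK p hp).2
  have ht : ∀ s : ℝ, ContinuousOn (fun p : Spacetime => p.1 ^ s) K := fun s p hp =>
    (contDiffAt_timePow (n := 0) s (hK p hp).1).continuousAt.continuousWithinAt
  have ht' : ContinuousOn (fun p : Spacetime => p.1⁻¹) K :=
    continuous_fst.continuousOn.inv₀ fun p hp => (hK p hp).1.ne'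
  have hb : ContinuousOn (fun p : Spacetime => gradTime δ p.1) K := fun p hp =>
    (contDiffAt_gradTime (n := 0) δ (hK p hp).1).continuousAt.continuousWithinAt
  have hω : ∀ i, ContinuousOn (omega i) K := fun i p hp =>
    (contDiffAt_omega (n := 0) i (hK p hp).2).continuousAt.continuousWithinAt
  have hω' : ∀ α, ContinuousOn (fun p => omegaHat p α) K := fun α =>
    Fin.cases continuousOn_const (fun i => hω i) α
  have hu : ∀ J, ContinuousOn (scaled ψ J) K := fun J => (hs J).continuous.continuousOn
  have hP : ∀ J α, ContinuousOn (partialDeriv α (scaled ψ J)) K := fun J α =>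
    (contDiff_partialDeriv (hs J) α).continuous.continuousOn
  have hPP : ∀ J α, ContinuousOn (partialDeriv α (partialDeriv α (scaled ψ J))) K := fun J α =>
    (continuous_partialDeriv (contDiff_partialDeriv (hs J) α) α).continuousOn
  have hY : ∀ J, ContinuousOn (radialDeriv (scaled ψ J)) K := fun J p hp =>
    (contDiffAt_radialDeriv (hs J) (hK p hp).2).continuousAt.continuousWithinAt
  have hX : ∀ J, ContinuousOn (mult (gradTime δ) (scaled ψ J)) K := fun J p hp =>
    (contDiffAt_mult δ (hs J) (hK p hp).1 (hK p hp).2).continuousAt.continuousWithinAt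
  have hbox : ContinuousOn (box (scaled ψ I)) K := by
    unfold box
    fun_prop
  have hpert : ContinuousOn (perturbation V W τ δ (scaled ψ) I) K := by
    unfold perturbation
    fun_prop
  have hmain : ContinuousOn (fun p => ‖p.2‖⁻¹ *
      (box (scaled ψ I) p - 2 * ‖p.2‖⁻¹ * radialDeriv (scaled ψ I) p
        - 2 * τ * mult (gradTime δ) (scaled ψ I) p
        + τ ^ 2 * (1 - gradTime δ p.1 ^ 2) * scaled ψ I p
        - τ * ((1 + δ) * (p.1 ^ (-1 - δ) * p.1⁻¹)) * scaled ψ I p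
        + perturbation V W τ δ (scaled ψ) I p)) K := by
    have h1 := ht (-1 - δ)
    have h2 := hX I
    fun_prop
  refine hmain.congr fun p hp => ?_
  beta_reduce
  rw [← radius_mul_conjWaveOp V W hδ τ R' ψ hs (hK p hp).1 (hK p hp).2 I, ← mul_assoc,
    inv_mul_cancel₀ (norm_ne_zero_iff.2 (hK p hp).2), one_mul]

end

theorem integrable_of_continuousOn_of_eq_zero {f : Spacetime → ℝ} {K : Set Spacetime}
    (hK : IsCompact K) (hf : ContinuousOn f K) (h0 : ∀ p ∉ K, f p = 0) : Integrable f :=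
  (hf.integrableOn_compact hK).integrable_of_forall_notMem_eq_zero h0

theorem integral_le_of_le_add_divergence {f g d : Spacetime → ℝ} {S : Set Spacetime} {τ C κ : ℝ}
    (hf : Integrable f) (hg : Integrable g) (hd : Integrable d) (hd0 : ∫ p in S, d p = 0)
    (hle : ∀ p, τ * f p ≤ C * g p + κ * d p) : τ * ∫ p in S, f p ≤ C * ∫ p in S, g p := by
  have hg' := hg.integrableOn (s := S).const_mul C
  have hd' := hd.integrableOn (s := S).const_mul κ
  have h := integral_mono (hf.integrableOn (s := S).const_mul τ) (hg'.add hd') hle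
  simp only [Pi.add_apply] at h
  rwa [integral_add hg' hd', integral_const_mul, integral_const_mul, integral_const_mul, hd0,
    mul_zero, add_zero] at h

/-- The Carleman inequality once the support of `ψ` lies at times where the pointwise inequality
holds. -/
theorem integrated_carleman {N : ℕ} {V : Fin N → Fin N → Fin 4 → Spacetime → ℝ}
    {W : Fin N → Fin N → Spacetime → ℝ} {ψ : Spacetime → EuclideanSpace ℝ (Fin N)}
    {δ τ R' T₀ ρ : ℝ} (hδ : δ ≠ 0) (hψ : ContDiff ℝ 2 ψ) (hcomp : HasCompactSupport ψ)
    (hsupp : tsupport ψ ⊆ region T₀ ρ) (hK : ∀ p ∈ tsupport ψ, 0 < p.1 ∧ p.2 ≠ 0)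
    (hV : ∀ I J α, ContinuousOn (V I J α) (tsupport ψ))
    (hW : ∀ I J, ContinuousOn (W I J) (tsupport ψ))
    (hpt : ∀ p ∈ tsupport ψ,
      τ * ((‖partialDeriv 0 ψ p‖ ^ 2 + (τ * ‖ψ p‖) ^ 2) * p.1 ^ (-δ)) ≤
        28 * (‖conjWaveOp V W τ δ R' ψ p‖ ^ 2 * p.1 ^ 2)
        + 28 * τ * ∑ J, ∑ α, partialDeriv α (carlemanCurrent τ δ (scaled ψ J) α) p) :
    τ * ∫ p in region T₀ ρ, (‖partialDeriv 0 ψ p‖ ^ 2 + (τ * ‖ψ p‖) ^ 2) * p.1 ^ (-δ)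
      ≤ 28 * ∫ p in region T₀ ρ, ‖conjWaveOp V W τ δ R' ψ p‖ ^ 2 * p.1 ^ 2 := by
  have hs := contDiff_scaled hψ fun p hp => (hK p hp).2
  have hsub : ∀ J α, tsupport (carlemanCurrent τ δ (scaled ψ J) α) ⊆ tsupport ψ := fun J α =>
    (tsupport_carlemanCurrent_subset τ δ α).trans (tsupport_scaled_subset J)
  have hZ : ∀ J α, ContDiff ℝ 1 (carlemanCurrent τ δ (scaled ψ J) α) := fun J α =>
    contDiff_of_contDiffAt_tsupport fun p hp =>
      contDiffAt_carlemanCurrent τ δ (hs J) (hK p (hsub J α hp)).1 (hK p (hsub J α hp)).2 α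
  have hZc : ∀ J α, HasCompactSupport (carlemanCurrent τ δ (scaled ψ J) α) := fun J α =>
    hcomp.of_isClosed_subset (isClosed_tsupport _) (hsub J α)
  have hdiv0 : ∀ p ∉ tsupport ψ,
      ∑ J, ∑ α, partialDeriv α (carlemanCurrent τ δ (scaled ψ J) α) p = 0 := fun p hp =>
    Finset.sum_eq_zero fun J _ => Finset.sum_eq_zero fun α _ =>
      partialDeriv_eq_zero_of_notMem (fun h => hp (hsub J α h)) α
  have hdivI : ∀ J α, Integrable (partialDeriv α (carlemanCurrent τ δ (scaled ψ J) α)) :=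
    fun J α => integrable_partialDeriv (hZ J α) (hZc J α) α
  have hdivint : Integrable fun p =>
      ∑ J, ∑ α, partialDeriv α (carlemanCurrent τ δ (scaled ψ J) α) p :=
    integrable_finsetSum _ fun J _ => integrable_finsetSum _ fun α _ => hdivI J α
  have hdiv : ∫ p in region T₀ ρ,
      ∑ J, ∑ α, partialDeriv α (carlemanCurrent τ δ (scaled ψ J) α) p = 0 := by
    rw [setIntegral_eq_integral_of_forall_compl_eq_zero fun p hp =>
        hdiv0 p fun h => hp (hsupp h),
      integral_finsetSum _ fun J _ => integrable_finsetSum _ fun α _ => hdivI J α]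
    refine Finset.sum_eq_zero fun J _ => ?_
    rw [integral_finsetSum _ fun α _ => hdivI J α]
    exact Finset.sum_eq_zero fun α _ => integral_partialDeriv (hZ J α) (hZc J α) α
  have hl0 : ∀ p ∉ tsupport ψ,
      (‖partialDeriv 0 ψ p‖ ^ 2 + (τ * ‖ψ p‖) ^ 2) * p.1 ^ (-δ) = 0 := fun p hp => by
    rw [partialDeriv_eq_zero_of_notMem hp, image_eq_zero_of_notMem_tsupport hp]
    simp
  have hr0 : ∀ p ∉ tsupport ψ, ‖conjWaveOp V W τ δ R' ψ p‖ ^ 2 * p.1 ^ 2 = 0 := fun p hp => by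
    rw [conjWaveOp_eq_zero τ δ R' hp]
    simp
  have hlint : Integrable fun p : Spacetime =>
      (‖partialDeriv 0 ψ p‖ ^ 2 + (τ * ‖ψ p‖) ^ 2) * p.1 ^ (-δ) := by
    refine integrable_of_continuousOn_of_eq_zero hcomp.isCompact ?_ hl0
    have h1 : Continuous (partialDeriv 0 ψ) :=
      continuous_partialDeriv (hψ.of_le (by norm_num)) 0
    have h2 := hψ.continuous
    exact Continuous.continuousOn (by fun_prop) |>.mul fun p hp =>
      (contDiffAt_timePow (n := 0) _ (hK p hp).1).continuousAt.continuousWithinAt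
  have hrint : Integrable fun p : Spacetime =>
      ‖conjWaveOp V W τ δ R' ψ p‖ ^ 2 * p.1 ^ 2 := by
    refine integrable_of_continuousOn_of_eq_zero hcomp.isCompact ?_ hr0
    have h1 := continuousOn_conjWaveOp hδ τ R' hV hW hK hs
    simp only [EuclideanSpace.norm_sq_eq, Real.norm_eq_abs, sq_abs]
    exact (continuousOn_finsetSum _ fun J _ => (h1 J).pow 2).mul
      (continuous_fst.pow 2).continuousOn
  refine integral_le_of_le_add_divergence (κ := 28 * τ) hlint hrint hdivint hdiv fun p => ?_
  by_cases hp : p ∈ tsupport ψ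
  · exact hpt p hp
  · rw [hl0 p hp, hr0 p hp, hdiv0 p hp, mul_zero, mul_zero, mul_zero, add_zero]

/-- The choice of `T_*`. The thresholds involve `γ` but not `δ`. -/
theorem exists_late_time (Ts M c γ : ℝ) (hγ : 0 < γ) :
    ∃ T, Ts ≤ T ∧ ∀ t, T ≤ t → 1 ≤ t ∧ M ≤ 1 / 100 * t ∧
      t ^ (-(1 / 2) : ℝ) ≤ 1 / 100 ∧ c ^ 2 * t ^ (-(1 / 2) : ℝ) ≤ 1 / 1000 ∧
      c ^ 2 * t ^ (-γ) ≤ 1 / 1000 := by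
  have h1 := tendsto_rpow_neg_atTop (show (0 : ℝ) < 1 / 2 by norm_num)
  have h2 := h1.const_mul (c ^ 2)
  have h3 := (tendsto_rpow_neg_atTop hγ).const_mul (c ^ 2)
  rw [mul_zero] at h2 h3
  have hev := (((Filter.eventually_ge_atTop (1 : ℝ)).and
    (Filter.eventually_ge_atTop (100 * M))).and
    ((h1.eventually_le_const (show (0 : ℝ) < 1 / 100 by norm_num)).and
    ((h2.eventually_le_const (show (0 : ℝ) < 1 / 1000 by norm_num)).and
    (h3.eventually_le_const (show (0 : ℝ) < 1 / 1000 by norm_num)))))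
  obtain ⟨T, hT⟩ := Filter.eventually_atTop.1 hev
  refine ⟨max Ts T, le_max_left _ _, fun t ht => ?_⟩
  obtain ⟨⟨a1, a2⟩, a3, a4, a5⟩ := hT t ((le_max_right _ _).trans ht)
  exact ⟨a1, by linarith, a3, a4, a5⟩

theorem CoeffBounds.abs {N : ℕ} {V : Fin N → Fin N → Fin 4 → Spacetime → ℝ}
    {W : Fin N → Fin N → Spacetime → ℝ} {C₁ γ : ℝ} {Ω : Set Spacetime}
    (h : CoeffBounds V W C₁ γ Ω) (hΩ : ∀ p ∈ Ω, 0 ≤ p.1) : CoeffBounds V W |C₁| γ Ω := by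
  have hpos : ∀ p ∈ Ω, ∀ s : ℝ, 0 ≤ (1 + p.1 + ‖p.2‖) ^ s := fun p hp s => by
    have := hΩ p hp
    positivity
  exact ⟨fun p hp => (h.1 p hp).trans (mul_le_mul_of_nonneg_right (le_abs_self _) (hpos p hp _)),
    fun p hp => (h.2 p hp).trans (mul_le_mul_of_nonneg_right (le_abs_self _) (hpos p hp _))⟩

end Spacetime
end

theorem mainTheorem3 :
    ∃ C τ₀ : ℝ, 0 < C ∧ 1 < τ₀ ∧
      ∀ R R'' Ts C₁ γ : ℝ, R'' < R → |R''| + 1 < Ts → 0 < γ → γ ≤ 1 →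
        ∃ Tstar : ℝ, Ts ≤ Tstar ∧
          ∀ (N : ℕ) (V : Fin N → Fin N → Fin 4 → Spacetime → ℝ)
            (W : Fin N → Fin N → Spacetime → ℝ),
            (∀ I J α, ContinuousOn (V I J α) (Spacetime.region Ts R'')) →
            (∀ I J, ContinuousOn (W I J) (Spacetime.region Ts R'')) →
            Spacetime.CoeffBounds V W C₁ γ (Spacetime.region Ts R'') →
            ∀ R' : ℝ, R'' < R' → R' < R →
            ∀ T₀ : ℝ, Tstar ≤ T₀ →
            ∀ τ : ℝ, τ₀ ≤ τ →
            ∀ δ : ℝ, 0 < δ → δ < γ → δ < 1 / 2 →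
            ∀ ψ : Spacetime → EuclideanSpace ℝ (Fin N),
              ContDiff ℝ 2 ψ → HasCompactSupport ψ →
              tsupport ψ ⊆ Spacetime.region T₀ R'' →
              tsupport ψ ⊆ {p : Spacetime | ‖p.2‖ - p.1 < R} →
              τ * ∫ p in Spacetime.region T₀ R'',
                  (‖Spacetime.partialDeriv 0 ψ p‖ ^ 2 + (τ * ‖ψ p‖) ^ 2) * p.1 ^ (-δ)
                ≤ C * ∫ p in Spacetime.region T₀ R'',
                    ‖Spacetime.conjWaveOp V W τ δ R' ψ p‖ ^ 2 * p.1 ^ 2 := by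
  refine ⟨28, 2, by norm_num, by norm_num, ?_⟩
  intro R R'' Ts C₁ γ _ hTs hγ _
  obtain ⟨Tstar, hTstar, hlate⟩ :=
    Spacetime.exists_late_time Ts (|R| + |R''|) |C₁| γ hγ
  refine ⟨Tstar, hTstar, ?_⟩
  intro N V W hV hW hVW R' _ _ T₀ hT₀ τ hτ δ hδ hδγ hδ1 ψ hψ hcomp hsupp hsuppR
  have hTs0 : 0 < Ts := by linarith [abs_nonneg R'']
  have hreg : tsupport ψ ⊆ Spacetime.region Ts R'' := fun p hp =>
    ⟨(hTstar.trans hT₀).trans (hsupp hp).1, (hsupp hp).2⟩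
  have hK : ∀ p ∈ tsupport ψ, 1 ≤ p.1 ∧ |‖p.2‖ - p.1| ≤ 1 / 100 * p.1 := by
    intro p hp
    obtain ⟨h1, h2, -⟩ := hlate p.1 (hT₀.trans (hsupp hp).1)
    refine ⟨h1, le_trans (abs_le.2 ⟨?_, ?_⟩) h2⟩
    · linarith [(hsupp hp).2, neg_abs_le R'', abs_nonneg R]
    · have : ‖p.2‖ - p.1 < R := hsuppR hp
      linarith [le_abs_self R, abs_nonneg R'']
  have hK' : ∀ p ∈ tsupport ψ, 0 < p.1 ∧ p.2 ≠ 0 := by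
    intro p hp
    obtain ⟨h1, h2⟩ := hK p hp
    refine ⟨by linarith, norm_pos_iff.1 ?_⟩
    linarith [(abs_le.1 h2).1]
  refine Spacetime.integrated_carleman hδ.ne' hψ hcomp hsupp hK'
    (fun I J α => (hV I J α).mono hreg) (fun I J => (hW I J).mono hreg) fun p hp => ?_
  obtain ⟨-, -, h3, h4, h5⟩ := hlate p.1 (hT₀.trans (hsupp hp).1)
  exact Spacetime.pointwise_carleman (abs_nonneg C₁)
    (hVW.abs fun q hq => hTs0.le.trans hq.1) (hreg hp) hψ
    (Spacetime.contDiff_scaled hψ fun q hq => (hK' q hq).2) hγ hδ hδγ hδ1 (by linarith)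
    (hK p hp).1 (hK p hp).2 h3 h4 h5
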